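/- Let $M$ be a smooth manifold of dimension $m$ and let $A\to M$ be a smooth (real or complex) vector bundle of rank $n$. Suppose that $A$ and its dual $A^*$ carry Lie algebroid structures $(A,[\cdot,\cdot],\rho)$ and $(A^*,[\cdot,\cdot]_*,\rho_*)$, with differentials $d$ on $\Gamma(\wedge^\bullet A^*)$ and $d_*$ on $\Gamma(\wedge^\bullet A)$, and that $(A,A^*)$ is a Lie bialgebroid, i.e. $d_*$ is a derivation of the Gerstenhaber algebra $(\Gamma(\wedge^\bullet A),\wedge,[\cdot,\cdot])$: $$d_*[u,v]=[d_*u,v]+(-1)^{k-1}[u,d_*v]\qquad (u\in\Gamma(\wedge^kA),\ v\in\Gamma(\wedge^lA)).$$ (In the complex case, functions, the anchors and forms on $M$ are complexified.) For $u\in\Gamma(A)$, let $\mathcal L_u$ denote the Lie derivative of the Lie algebroid $A$: on $\Gamma(\wedge^\bullet A^*)$ it is $\iota_u d+d\,\iota_u$, on $\Gamma(\wedge^\bullet A)$ it is $[u,\cdot]$, and on differential forms on $M$ it is the usual Lie derivative along $\rho(u)$. For $\theta\in\Gamma(A^*)$, $\mathcal L_\theta$ is defined likewise from the Lie algebroid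 $A^*$. Let $s\in\Gamma(\wedge^mT^*M)$ be a volume form, $\Omega\in\Gamma(\wedge^nA^*)$ a nowhere vanishing section, and $V\in\Gamma(\wedge^nA)$ the section dual to it, $\langle\Omega,V\rangle=1$. Let $X_0\in\Gamma(A)$ and $\xi_0\in\Gamma(A^*)$ be the modular cocycles, i.e. the sections determined by $$(\mathcal L_\theta\Omega)\otimes s+\Omega\otimes\mathcal L_\theta s=\langle X_0,\theta\rangle\,\Omega\otimes s\quad\text{for all }\theta\in\Gamma(A^*),$$ $$(\mathcal L_us)\otimes V+s\otimes\mathcal L_uV=\langle\xi_0,u\rangle\,s\otimes V\quad\text{for all }u\in\Gamma(A).$$ For $u\in\Gamma(A)$ and $\theta\in\Gamma(A^*)$ let $\partial u$ and $\partial_*\theta$ be the functions determined by $(\partial u)\,\Omega=-d(\iota_u\Omega)$ and $(\partial_*\theta)\,V=-d_*(\iota_\theta V)$; these are the values on sections of the Batalin–Vilkovisky operators dual to $d$ with respect to $\Omega$ and to $d_*$ with respect to $V$. Then 1. $\mathcal L_{X_0}V=-\mathcal L_{\xi_0}V$; 2. $\mathcal L_{X_0}\Omega=-\mathcal L_{\xi_0}\Omega$;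 3. $\partial_*\xi_0=\partial X_0$; 4. $\mathcal L_{X_0}s=\mathcal L_{\xi_0}s$. -/

import Mathlib

open Bundle Module
open scoped Manifold ContDiff Topology

noncomputable section

/-! ### Lie algebroids in terms of sections

`R` is the ring of smooth functions, `L` the `R`-module of sections of a vector bundle, and
`Dual R L` the module of sections of the dual bundle.  Vector fields are derivations of `R`. -/

section Algebra

variable {R : Type*} [CommRing R] [Algebra ℝ R]
variable {L : Type*} [AddCommGroup L] [Module R L]

variable (R L) in
/-- A Lie algebroid structure on a vector bundle with module of sections `L`: a Lie bracket on
sections and an anchor, i.e. an `R`-linear map to vector fields, which is a morphism for the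
brackets and satisfies the Leibniz rule.  (Linearity of the bracket over the constants follows
from the Leibniz rule.) -/
structure LieAlgebroid where
  bracket : L →+ L →+ L
  anchor : L →ₗ[R] Derivation ℝ R R
  bracket_self : ∀ X, bracket X X = 0
  jacobi : ∀ X Y Z, bracket X (bracket Y Z) = bracket (bracket X Y) Z + bracket Y (bracket X Z)
  anchor_bracket : ∀ X Y, anchor (bracket X Y) = ⁅anchor X, anchor Y⁆
  leibniz : ∀ (X : L) (f : R) (Y : L), bracket X (f • Y) = anchor X f • Y + f • bracket X Y

/-- Given a vector field `D` and an operator `δ` on sections, the induced operator on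
`k`-cochains (`R`-valued functions of `k` sections, in particular `k`-forms):
`(D·α)(Y₁, …, Y_k) = D (α(Y₁, …, Y_k)) - ∑ᵢ α(Y₁, …, δ Yᵢ, …, Y_k)`. -/
def cochainLie (D : Derivation ℝ R R) (δ : L → L) {k : ℕ} (α : (Fin k → L) → R) :
    (Fin k → L) → R :=
  fun Y => D (α Y) - ∑ i, α (Function.update Y i (δ (Y i)))

/-- Insertion of a section in the first slot, `ι_X α`. -/
def insertFirst (X : L) {k : ℕ} (α : (Fin (k + 1) → L) → R) : (Fin k → L) → R :=
  fun Y => α (Fin.cons X Y)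

/-- The Lie derivative of an `m`-form on the base manifold along a vector field. -/
def vectorFieldLie (D : Derivation ℝ R R) {k : ℕ} (s : (Fin k → Derivation ℝ R R) → R) :
    (Fin k → Derivation ℝ R R) → R :=
  cochainLie D (fun Y => ⁅D, Y⁆) s

namespace LieAlgebroid

variable (𝒜 : LieAlgebroid R L)

/-- The Lie algebroid differential of a `k`-form. -/
def d : {k : ℕ} → ((Fin k → L) → R) → (Fin (k + 1) → L) → R
  | 0, α => fun X => 𝒜.anchor (X 0) (α Fin.elim0)
  | k + 1, α => fun X =>
      ∑ i : Fin (k + 2), (-1) ^ (i : ℕ) * 𝒜.anchor (X i) (α (i.removeNth X))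
      + ∑ j : Fin (k + 2), ∑ i : Fin (k + 1) with i.castSucc < j, (-1) ^ ((i : ℕ) + (j : ℕ)) *
          α (Fin.cons (𝒜.bracket (X i.castSucc) (X j)) (i.removeNth (j.removeNth X)))

/-- The differential of a function, as a section of the dual bundle. -/
def dFun (f : R) : Dual R L where
  toFun X := 𝒜.anchor X f
  map_add' := by simp
  map_smul' := by simp

/-- The Lie derivative `L_X α` of a `k`-form on the Lie algebroid (a section of `∧ᵏ` of the dual
bundle): `(L_X α)(Y₁, …) = ρ(X)(α(Y₁, …)) - ∑ᵢ α(…, [X, Yᵢ], …)`. -/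
def lieForm (X : L) {k : ℕ} (α : (Fin k → L) → R) : (Fin k → L) → R :=
  cochainLie (𝒜.anchor X) (𝒜.bracket X) α

/-- The Lie derivative `L_X θ` of a section of the dual bundle:
`⟨L_X θ, Y⟩ = ρ(X)⟨θ, Y⟩ - ⟨θ, [X, Y]⟩`. -/
def lieDual (X : L) (θ : Dual R L) : Dual R L where
  toFun Y := 𝒜.anchor X (θ Y) - θ (𝒜.bracket X Y)
  map_add' Y Z := by simp only [map_add]; ring
  map_smul' f Y := by
    simp only [map_smul, 𝒜.leibniz, map_add, smul_eq_mul, Derivation.leibniz, RingHom.id_apply]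
    ring

/-- The Lie derivative `L_X P = [X, P]` of a `k`-vector `P` (a section of `∧ᵏ` of the bundle itself,
viewed as an alternating form on the dual bundle): the derivation of the exterior algebra
extending the bracket, i.e. `(L_X P)(θ₁, …) = ρ(X)(P(θ₁, …)) - ∑ᵢ P(…, L_X θᵢ, …)`. -/
def lieVec (X : L) {k : ℕ} (P : (Fin k → Dual R L) → R) : (Fin k → Dual R L) → R :=
  cochainLie (𝒜.anchor X) (𝒜.lieDual X) P

/-- The Schouten bracket `[P, f] = (-1)ᵏ ι_{df} P` of a `(k+1)`-vector with a function. -/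
def schoutenFun {k : ℕ} (P : (Fin (k + 1) → Dual R L) → R) (f : R) : (Fin k → Dual R L) → R :=
  (-1 : R) ^ k • insertFirst (𝒜.dFun f) P

end LieAlgebroid

/-! ### Pairs of Lie algebroid structures in duality -/

/-- A section `X` as a `1`-vector, i.e. as a form of degree one on the dual bundle. -/
def oneVec (X : L) : (Fin 1 → Dual R L) → R := fun θ => θ 0 X

/-- A function as a `0`-vector. -/
def zeroVec (f : R) : (Fin 0 → Dual R L) → R := fun _ => f

/-- `(A, A*)` is a Lie bialgebroid: the differential `d_*` of `A*`, acting on multivectors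
(sections of `∧A`), is a derivation of the Gerstenhaber bracket of `A`,
`d_*[u, v] = [d_* u, v] + (-1)^(k-1) [u, d_* v]` for `u` of degree `k`.
As `d_*` is a derivation of `∧` and the bracket is a graded-antisymmetric biderivation of `∧`,
this is a condition on the generators of `Γ(∧A)`, i.e. on functions and sections; it is stated
on these. The cases of degrees `(0, 0)`, `(1, 0)`, `(1, 1)` are
`0 = [d_* f, g] - [f, d_* g]`, where `[f, d_* g] = -[d_* g, f]`;
`d_*[X, f] = [d_* X, f] + [X, d_* f]`; and
`d_*[X, Y] = [d_* X, Y] + [X, d_* Y]`, where `[d_* X, Y] = -[Y, d_* X] = -L_Y (d_* X)`. -/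
structure IsLieBialgebroid (𝒜 : LieAlgebroid R L) (𝒜' : LieAlgebroid R (Dual R L)) : Prop where
  fun_fun : ∀ f g : R,
    𝒜.schoutenFun (𝒜'.d (zeroVec f)) g + 𝒜.schoutenFun (𝒜'.d (zeroVec g)) f = 0
  sec_fun : ∀ (X : L) (f : R),
    𝒜'.d (zeroVec (𝒜.anchor X f)) =
      𝒜.schoutenFun (𝒜'.d (oneVec X)) f + 𝒜.lieVec X (𝒜'.d (zeroVec f))
  sec_sec : ∀ X Y : L,
    𝒜'.d (oneVec (𝒜.bracket X Y)) =
      -𝒜.lieVec Y (𝒜'.d (oneVec X)) + 𝒜.lieVec X (𝒜'.d (oneVec Y))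

/-- For `θ ∈ Γ(A*)` and `u ∈ Γ(A) = Γ(A**)`, the Lie derivative `L_θ u ∈ Γ(A)` for the Lie
algebroid `A*`: `⟨L_θ u, η⟩ = ρ_*(θ)⟨u, η⟩ - ⟨u, [θ, η]_*⟩`. -/
def lieBidual [IsReflexive R L] (𝒜' : LieAlgebroid R (Dual R L)) (θ : Dual R L) (u : L) : L :=
  (evalEquiv R L).symm (𝒜'.lieDual θ (Dual.eval R L u))

/-- For `θ ∈ Γ(A*)`, the Lie derivative `L_θ Ω = [θ, Ω]_*` of a section `Ω` of `∧ᵏA*`, viewed as an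
alternating form on `A = A**`. -/
def lieCovec [IsReflexive R L] (𝒜' : LieAlgebroid R (Dual R L)) (θ : Dual R L) {k : ℕ}
    (Ω : (Fin k → L) → R) : (Fin k → L) → R :=
  cochainLie (𝒜'.anchor θ) (lieBidual 𝒜' θ) Ω

/-- `V ∈ Γ(∧ⁿA)` is dual to `Ω ∈ Γ(∧ⁿA*)`, `n` the rank of `A`: `⟨Ω, V⟩ = 1`, i.e.
`u₁ ∧ ⋯ ∧ uₙ = Ω(u₁, …, uₙ) V` for all sections `u₁, …, uₙ` of `A`, where `u₁ ∧ ⋯ ∧ uₙ` is the form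
`(θ₁, …, θₙ) ↦ det (θᵢ(uⱼ))` on `A*`. -/
def IsDualVolume {n : ℕ} (Ω : L [⋀^Fin n]→ₗ[R] R) (V : Dual R L [⋀^Fin n]→ₗ[R] R) : Prop :=
  ∀ (u : Fin n → L) (θ : Fin n → Dual R L),
    Matrix.det (Matrix.of fun i j => θ i (u j)) = Ω u * V θ

/-- `∂X = f`, for `X` a section of a Lie algebroid of rank `n` and `Ω` a nowhere vanishing form of
top degree `n`: the operator `∂` is dual to the differential, `ι_{∂β} Ω = (-1)ˡ d(ι_β Ω)` on
`l`-vectors `β`; on sections, `(∂X) Ω = -d(ι_X Ω)` (and `ι_X Ω = 0`, so `∂X = 0`, if `n = 0`). -/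
def LieAlgebroid.IsBV (𝒜 : LieAlgebroid R L) :
    {n : ℕ} → ((Fin n → L) → R) → L → R → Prop
  | 0, Ω, _, f => f • Ω = 0
  | _ + 1, Ω, X, f => f • Ω = -𝒜.d (insertFirst X Ω)

/-- `X₀ ∈ Γ(A)` is the modular cocycle of `A*` with respect to `Ω` and `s`:
`(L_θ Ω) ⊗ s + Ω ⊗ L_{ρ_*(θ)} s = ⟨X₀, θ⟩ Ω ⊗ s` for all `θ ∈ Γ(A*)`. -/
def IsModularCocycleDual [IsReflexive R L] (𝒜' : LieAlgebroid R (Dual R L)) {n m : ℕ}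
    (Ω : (Fin n → L) → R) (s : (Fin m → Derivation ℝ R R) → R) (X₀ : L) : Prop :=
  ∀ (θ : Dual R L) (u : Fin n → L) (Y : Fin m → Derivation ℝ R R),
    lieCovec 𝒜' θ Ω u * s Y + Ω u * vectorFieldLie (𝒜'.anchor θ) s Y = θ X₀ * (Ω u * s Y)

/-- `ξ₀ ∈ Γ(A*)` is the modular cocycle of `A` with respect to `s` and `V`:
`(L_{ρ(u)} s) ⊗ V + s ⊗ L_u V = ⟨ξ₀, u⟩ s ⊗ V` for all `u ∈ Γ(A)`. -/
def IsModularCocycle (𝒜 : LieAlgebroid R L) {n m : ℕ}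
    (s : (Fin m → Derivation ℝ R R) → R) (V : (Fin n → Dual R L) → R) (ξ₀ : Dual R L) : Prop :=
  ∀ (u : L) (Y : Fin m → Derivation ℝ R R) (θ : Fin n → Dual R L),
    vectorFieldLie (𝒜.anchor u) s Y * V θ + s Y * 𝒜.lieVec u V θ = ξ₀ u * (s Y * V θ)

end Algebra

/-! ### Smooth real or complex vector bundles -/

section Geometry

/-- Multiplication in `𝕜 = ℝ` or `ℂ` is smooth over `ℝ`. -/
instance instContMDiffRingRCLike {𝕜 : Type*} [RCLike 𝕜] {n : ℕ∞ω} :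
    ContMDiffRing 𝓘(ℝ, 𝕜) n 𝕜 :=
  { instNormedSpaceLieAddGroup with
    contMDiff_mul := by
      rw [← modelWithCornersSelf_prod, chartedSpaceSelf_prod]
      exact contDiff_mul.contMDiff }

variable {m : ℕ} {M : Type*} [TopologicalSpace M] [ChartedSpace (EuclideanSpace ℝ (Fin m)) M]

variable (𝕜 : Type*) [RCLike 𝕜] (m M) in
/-- The ring `C^∞(M, 𝕜)` of smooth `𝕜`-valued functions on a real manifold `M`. -/
abbrev SmoothFun : Type _ := C^∞⟮𝓡 m, M; 𝓘(ℝ, 𝕜), 𝕜⟯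

variable {𝕜 : Type*} [RCLike 𝕜]
  {F : Type*} [NormedAddCommGroup F] [NormedSpace ℝ F] [NormedSpace 𝕜 F] [IsScalarTower ℝ 𝕜 F]
  {A : M → Type*} [TopologicalSpace (TotalSpace F A)] [∀ x, TopologicalSpace (A x)]
  [∀ x, AddCommGroup (A x)] [∀ x, Module ℝ (A x)] [∀ x, Module 𝕜 (A x)]
  [FiberBundle F A] [VectorBundle ℝ F A] [VectorBundle 𝕜 F A]

variable (F A) (m) in
/-- The smooth sections of a vector bundle over `M`. -/
abbrev SmoothSec : Type _ := Cₛ^∞⟮𝓡 m; F, A⟯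

/-- The product of a smooth `𝕜`-valued function and a smooth section. -/
instance instSMulSmoothSec : SMul (SmoothFun m M 𝕜) (SmoothSec m F A) where
  smul f σ :=
    { toFun := fun x => f x • σ x
      contMDiff_toFun := by
        intro x₀
        have hσ := σ.contMDiff x₀
        rw [contMDiffAt_section] at hσ ⊢
        set e := trivializationAt F A x₀
        have h : ContMDiffAt (𝓡 m) 𝓘(ℝ, F) ∞ (fun x => f x • (e ⟨x, σ x⟩).2) x₀ :=
          (contDiff_smul (𝕜 := ℝ) (𝕜' := 𝕜) (F := F)).contMDiff.contMDiffAt.comp x₀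
            ((f.contMDiff x₀).prodMk_space hσ)
        refine h.congr_of_eventuallyEq ?_
        filter_upwards [e.open_baseSet.mem_nhds (mem_baseSet_trivializationAt F A x₀)] with x hx
        exact (e.linear 𝕜 hx).2 _ _ }

/-- `Γ(A)` as a module over `C^∞(M, 𝕜)`. -/
instance instModuleSmoothSec : Module (SmoothFun m M 𝕜) (SmoothSec m F A) where
  one_smul σ := by ext x; exact one_smul 𝕜 (σ x)
  mul_smul f g σ := by ext x; exact mul_smul (f x) (g x) (σ x)
  smul_zero f := by ext x; exact smul_zero (f x)
  smul_add f σ τ := by ext x; exact smul_add (f x) (σ x) (τ x)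
  add_smul f g σ := by ext x; exact add_smul (f x) (g x) (σ x)
  zero_smul σ := by ext x; exact zero_smul 𝕜 (σ x)

/-- Near each point a smooth vector bundle has a frame, cut off by a bump function `χ`. -/
theorem exists_cutoff_frame [FiniteDimensional 𝕜 F] [T2Space M] [IsManifold (𝓡 m) ∞ M]
    [ContMDiffVectorBundle ∞ F A (𝓡 m)] (x₀ : M) :
    ∃ (χ : SmoothFun m M 𝕜) (σ : Fin (finrank 𝕜 F) → SmoothSec m F A)
      (θ : Fin (finrank 𝕜 F) → Dual (SmoothFun m M 𝕜) (SmoothSec m F A)),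
      (∀ᶠ x in 𝓝 x₀, χ x = 1) ∧ (∀ u, (χ * χ) • u = ∑ i, θ i u • σ i) ∧
      ∀ i u v x, u x = v x → θ i u x = θ i v x := by
  set e := trivializationAt F A x₀ with he
  have hx₀ : x₀ ∈ e.baseSet := mem_baseSet_trivializationAt F A x₀
  obtain ⟨f, hf, -⟩ := (SmoothBumpFunction.nhds_basis_support (I := 𝓡 m)
    (e.open_baseSet.mem_nhds hx₀)).mem_iff.1 (e.open_baseSet.mem_nhds hx₀)
  let b := finBasis 𝕜 F
  have hsm : ∀ (x : M) (r : ℝ) (v : A x), x ∈ e.baseSet → r • v = (r : 𝕜) • v := by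
    intro x r v hx
    apply (e.continuousLinearEquivAt 𝕜 x hx).injective
    have h1 := (e.linear ℝ hx).2 r v
    have h2 := (e.linear 𝕜 hx).2 (r : 𝕜) v
    have h3 : (r : 𝕜) • (e ⟨x, v⟩).2 = r • (e ⟨x, v⟩).2 := by
      exact algebraMap_smul 𝕜 r (e ⟨x, v⟩).2
    exact h1.trans (h3.symm.trans h2.symm)
  have hcoord : ∀ i, ContDiff ℝ ∞ (fun w : F => b.repr w i) := fun i =>
    ((LinearMap.toContinuousLinearMap (b.coord i)).restrictScalars ℝ).contDiff
  let χ : SmoothFun m M 𝕜 := ⟨fun x => ((f x : ℝ) : 𝕜),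
    (RCLike.ofRealCLM (K := 𝕜)).contDiff.contMDiff.comp f.contMDiff⟩
  let σ : Fin (finrank 𝕜 F) → SmoothSec m F A := fun i =>
    ⟨(f : M → ℝ) • fun x => e.symm x (b i), by
      refine ContMDiffOn.smul_section_of_tsupport f.contMDiff.contMDiffOn e.open_baseSet hf ?_
      rw [e.contMDiffOn_section_baseSet_iff]
      refine (contMDiffOn_const (c := b i)).congr fun x hx => ?_
      rw [e.apply_mk_symm hx]⟩
  have hθ : ∀ (i) (u : SmoothSec m F A),
      ContMDiff (𝓡 m) 𝓘(ℝ, 𝕜) ∞ (fun x => f x • b.repr (e ⟨x, u x⟩).2 i) := by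
    intro i u
    refine contMDiff_of_tsupport fun x hx => ?_
    have hxe : x ∈ e.baseSet := hf (tsupport_smul_subset_left _ _ hx)
    have hu := (e.contMDiffAt_section_iff hxe).1 (u.contMDiff x)
    exact f.contMDiffAt.smul ((hcoord i).contMDiff.contMDiffAt.comp x hu)
  have hzero : ∀ x, x ∉ e.baseSet → f x = 0 := fun x hx =>
    image_eq_zero_of_notMem_tsupport fun h => hx (hf h)
  let θ : Fin (finrank 𝕜 F) → Dual (SmoothFun m M 𝕜) (SmoothSec m F A) := fun i =>
    { toFun := fun u => ⟨_, hθ i u⟩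
      map_add' := by
        intro u v
        ext x
        change f x • b.repr (e ⟨x, u x + v x⟩).2 i =
          f x • b.repr (e ⟨x, u x⟩).2 i + f x • b.repr (e ⟨x, v x⟩).2 i
        by_cases hx : x ∈ e.baseSet
        · rw [(e.linear 𝕜 hx).1 (u x) (v x)]
          simp [smul_add]
        · simp [hzero x hx]
      map_smul' := by
        intro g u
        ext x
        change f x • b.repr (e ⟨x, g x • u x⟩).2 i = g x * (f x • b.repr (e ⟨x, u x⟩).2 i)
        by_cases hx : x ∈ e.baseSet
        · rw [(e.linear 𝕜 hx).2 (g x) (u x)]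
          simp
        · simp [hzero x hx] }
  refine ⟨χ, σ, θ, ?_, ?_, ?_⟩
  · filter_upwards [f.eventuallyEq_one] with x hx
    change ((f x : ℝ) : 𝕜) = 1
    rw [hx]; simp
  · intro u
    ext x
    have hsum : (∑ i, θ i u • σ i : SmoothSec m F A) x = ∑ i, (θ i u • σ i) x := by
      have := congrFun (map_sum (ContMDiffSection.coeAddHom (𝓡 m) F ∞ A)
        (fun i => θ i u • σ i) Finset.univ) x
      rw [Finset.sum_apply] at this
      exact this
    rw [hsum]
    change (((f x : ℝ) : 𝕜) * ((f x : ℝ) : 𝕜)) • u x =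
      ∑ i, (f x • b.repr (e ⟨x, u x⟩).2 i) • (f x • e.symm x (b i))
    by_cases hx : x ∈ e.baseSet
    · have hu : u x = ∑ i, b.repr (e ⟨x, u x⟩).2 i • e.symm x (b i) := by
        apply (e.continuousLinearEquivAt 𝕜 x hx).injective
        rw [map_sum]
        simp only [map_smul]
        have h1 : ∀ i, e.continuousLinearEquivAt 𝕜 x hx (e.symm x (b i)) = b i := fun i => by
          change (e ⟨x, e.symm x (b i)⟩).2 = b i
          rw [e.apply_mk_symm hx]
        simp only [h1]
        exact (b.sum_repr _).symm
      conv_lhs => rw [hu]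
      rw [Finset.smul_sum]
      refine Finset.sum_congr rfl fun i _ => ?_
      rw [hsm x (f x) _ hx, smul_smul, smul_smul, RCLike.real_smul_eq_coe_mul]
      ring_nf
    · simp [hzero x hx]
  · intro i u v x h
    change f x • b.repr (e ⟨x, u x⟩).2 i = f x • b.repr (e ⟨x, v x⟩).2 i
    rw [h]

/-- `Γ(A) = Γ(A**)`: the module of sections of a smooth vector bundle is reflexive. -/
instance instIsReflexiveSmoothSec [FiniteDimensional 𝕜 F] [T2Space M] [IsManifold (𝓡 m) ∞ M]
    [ContMDiffVectorBundle ∞ F A (𝓡 m)] :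
    IsReflexive (SmoothFun m M 𝕜) (SmoothSec m F A) where
  bijective_dual_eval' := by
    choose χ σ θ h1 h2 h3 using fun x₀ : M =>
      exists_cutoff_frame (m := m) (𝕜 := 𝕜) (F := F) (A := A) x₀
    have hsum : ∀ {ι : Type} (t : Finset ι) (g : ι → SmoothSec m F A) (x : M),
        (∑ i ∈ t, g i) x = ∑ i ∈ t, g i x := by
      intro ι t g x
      have := congrFun (map_sum (ContMDiffSection.coeAddHom (𝓡 m) F ∞ A) g t) x
      rw [Finset.sum_apply] at this
      exact this
    have hsumR : ∀ {ι : Type} (t : Finset ι) (g : ι → SmoothFun m M 𝕜) (x : M),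
        (∑ i ∈ t, g i) x = ∑ i ∈ t, g i x := by
      intro ι t g x
      have := congrFun (map_sum (ContMDiffMap.coeFnAddMonoidHom
        (I := 𝓡 m) (I' := 𝓘(ℝ, 𝕜)) (N := M) (n := ∞) (G := 𝕜)) g t) x
      rw [Finset.sum_apply] at this
      exact this
    have h2' : ∀ x₀ y (u : SmoothSec m F A), χ x₀ y = 1 →
        u y = ∑ i, θ x₀ i u y • σ x₀ i y := by
      intro x₀ y u hy
      have := congrArg (fun s : SmoothSec m F A => s y) (h2 x₀ u)
      simp only [hsum] at this
      change (χ x₀ y * χ x₀ y) • u y = ∑ i, θ x₀ i u y • σ x₀ i y at this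
      simpa [hy] using this
    -- sections are separated at each point by dual sections
    have hsep : ∀ y (u v : SmoothSec m F A),
        (∀ η : Dual (SmoothFun m M 𝕜) (SmoothSec m F A), η u y = η v y) → u y = v y := by
      intro y u v h
      rw [h2' y y u (h1 y).self_of_nhds, h2' y y v (h1 y).self_of_nhds]
      simp only [h]
    have hloc : ∀ (η : Dual (SmoothFun m M 𝕜) (SmoothSec m F A)) x₀ y u, χ x₀ y = 1 →
        η u y = ∑ i, θ x₀ i u y * η (σ x₀ i) y := by
      intro η x₀ y u hy
      have := congrArg (fun g : SmoothFun m M 𝕜 => g y) (congrArg η (h2 x₀ u))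
      simp only [map_smul, map_sum, hsumR] at this
      change (χ x₀ y * χ x₀ y) * η u y = ∑ i, θ x₀ i u y * η (σ x₀ i) y at this
      simpa [hy] using this
    constructor
    · intro u v h
      ext y
      refine hsep y u v fun η => ?_
      have := congrArg (fun φ => φ η y) h
      simpa using this
    · intro φ
      let w : M → SmoothSec m F A := fun x₀ => ∑ i, φ (θ x₀ i) • σ x₀ i
      have hw : ∀ (η : Dual (SmoothFun m M 𝕜) (SmoothSec m F A)) x₀ y, χ x₀ y = 1 →
          η (w x₀) y = φ η y := by
        intro η x₀ y hy
        have h4 : (χ x₀ * χ x₀) • η = ∑ i, η (σ x₀ i) • θ x₀ i := by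
          ext1 u
          rw [LinearMap.smul_apply, ← map_smul, h2 x₀ u]
          simp [mul_comm, LinearMap.sum_apply]
        have h5 := congrArg (fun g : SmoothFun m M 𝕜 => g y) (congrArg φ h4)
        simp only [map_smul, map_sum, hsumR] at h5
        change (χ x₀ y * χ x₀ y) * φ η y = ∑ i, η (σ x₀ i) y * φ (θ x₀ i) y at h5
        rw [hy, one_mul, one_mul] at h5
        rw [h5]
        simp only [w, map_sum, map_smul, hsumR]
        exact Finset.sum_congr rfl fun i _ => mul_comm _ _
      have hw' : ∀ x₀ y, χ x₀ y = 1 → w y y = w x₀ y := fun x₀ y hy =>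
        hsep y _ _ fun η => by rw [hw η x₀ y hy, hw η y y (h1 y).self_of_nhds]
      let u : SmoothSec m F A :=
        ⟨fun y => w y y, fun x₀ => by
          refine ((w x₀).contMDiff x₀).congr_of_eventuallyEq ?_
          filter_upwards [h1 x₀] with y hy
          rw [hw' x₀ y hy]⟩
      refine ⟨u, ?_⟩
      ext η y
      rw [Dual.eval_apply, ← hw η y y (h1 y).self_of_nhds,
        hloc η y y u (h1 y).self_of_nhds, hloc η y y (w y) (h1 y).self_of_nhds]
      refine Finset.sum_congr rfl fun i _ => ?_
      rw [h3 y i u (w y) y rfl]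

/-- A form `α` on a bundle (given by its values on sections) vanishes at no point of `M`. -/
def NowhereVanishing {L : Type*} {k : ℕ} (α : (Fin k → L) → SmoothFun m M 𝕜) : Prop :=
  ∀ x : M, ∃ u : Fin k → L, α u x ≠ 0

end Geometry

end

/-! With respect to a nowhere vanishing top form, every derivation of the module of sections acts on
top forms by multiplication by a function, its divergence. In these terms the two modular cocycles
are sums of a divergence along the bundle and one along the base,
`⟨X₀, θ⟩ = div L_θ + div ρ_*(θ)` and `⟨ξ₀, u⟩ = div ρ(u) - div L_u`,
and all four identities become equalities of divergences.

The bialgebroid condition for a section and a function reads `L_{df} X = [X, d_* f]`, and it makes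
`ρ(d_* f) = -ρ_*(df)`, so that `(f, g) ↦ ρ_*(df) g` is antisymmetric. Evaluating the cocycles on
`d_* f` and `df` shows that `Z = ρ(X₀) - ρ_*(ξ₀)` acts on functions by `Z f = div (2 ρ_*(df))`:
it is the divergence of a bivector field, hence itself divergence-free, by the symmetry of second
partial derivatives. This is the fourth identity; comparing the two expressions for `⟨ξ₀, X₀⟩`
then gives `div L_{ξ₀} = -div L_{X₀}`, which is the content of the other three. -/

noncomputable section

section Volume

variable {R : Type*} [CommRing R] {L : Type*} [AddCommGroup L] [Module R L]

/-- `α` is a volume form: it generates freely the `R`-module of forms of its degree. -/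
def IsVolumeForm {k : ℕ} (α : L [⋀^Fin k]→ₗ[R] R) : Prop :=
  Function.Bijective fun f : R => f • α

theorem IsVolumeForm.eq_of_forall_mul_eq {k : ℕ} {α : L [⋀^Fin k]→ₗ[R] R} (hα : IsVolumeForm α)
    {f g : R} (h : ∀ u, f * α u = g * α u) : f = g :=
  hα.1 (AlternatingMap.ext h)

variable [Algebra ℝ R]

/-- `δ` is a derivation of the module `L` over the derivation `D` of the ring `R`: a covariant
differential operator of order one on sections, with symbol the vector field `D`. -/
structure IsModuleDerivation (D : Derivation ℝ R R) (δ : L → L) : Prop where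
  add : ∀ X Y, δ (X + Y) = δ X + δ Y
  smul : ∀ (f : R) X, δ (f • X) = D f • X + f • δ X

theorem isModuleDerivation_lie (D : Derivation ℝ R R) :
    IsModuleDerivation D (fun Y : Derivation ℝ R R => ⁅D, Y⁆) where
  add := lie_add D
  smul f Y := by
    ext g
    simp only [Derivation.commutator_apply, Derivation.smul_apply, Derivation.add_apply,
      smul_eq_mul, Derivation.leibniz]
    ring

namespace IsModuleDerivation

variable {D : Derivation ℝ R R} {δ : L → L} {k : ℕ}

theorem cochainLie_update_add (hδ : IsModuleDerivation D δ) (α : L [⋀^Fin k]→ₗ[R] R)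
    (Y : Fin k → L) (j : Fin k) (a b : L) :
    cochainLie D δ α (Function.update Y j (a + b)) =
      cochainLie D δ α (Function.update Y j a) + cochainLie D δ α (Function.update Y j b) := by
  have hsummand : ∀ i, α (Function.update (Function.update Y j (a + b)) i
        (δ (Function.update Y j (a + b) i))) =
      α (Function.update (Function.update Y j a) i (δ (Function.update Y j a i))) +
      α (Function.update (Function.update Y j b) i (δ (Function.update Y j b i))) := by
    intro i
    by_cases hij : i = j
    · subst hij
      simp [hδ.add]
    · simp only [Function.update_of_ne hij, Function.update_comm (Ne.symm hij),
        AlternatingMap.map_update_add]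
  simp only [cochainLie, AlternatingMap.map_update_add, map_add, hsummand, Finset.sum_add_distrib]
  ring

theorem cochainLie_update_smul (hδ : IsModuleDerivation D δ) (α : L [⋀^Fin k]→ₗ[R] R)
    (Y : Fin k → L) (j : Fin k) (f : R) (a : L) :
    cochainLie D δ α (Function.update Y j (f • a)) =
      f • cochainLie D δ α (Function.update Y j a) := by
  have hsummand : ∀ i, α (Function.update (Function.update Y j (f • a)) i
        (δ (Function.update Y j (f • a) i))) =
      (if i = j then D f * α (Function.update Y j a) else 0) +
      f * α (Function.update (Function.update Y j a) i (δ (Function.update Y j a i))) := by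
    intro i
    by_cases hij : i = j
    · subst hij
      simp [hδ.smul]
    · simp only [Function.update_of_ne hij, Function.update_comm (Ne.symm hij),
        AlternatingMap.map_update_smul, if_neg hij, smul_eq_mul, zero_add]
  simp only [cochainLie, AlternatingMap.map_update_smul, smul_eq_mul, Derivation.leibniz, hsummand,
    Finset.sum_add_distrib, Finset.sum_ite_eq', Finset.mem_univ, if_true, ← Finset.mul_sum]
  ring

end IsModuleDerivation

theorem cochainLie_eq_zero_of_eq (D : Derivation ℝ R R) (δ : L → L) {k : ℕ}
    (α : L [⋀^Fin k]→ₗ[R] R) {Y : Fin k → L} {i j : Fin k} (hY : Y i = Y j) (hij : i ≠ j) :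
    cochainLie D δ α Y = 0 := by
  have hpair : α (Function.update Y i (δ (Y i))) + α (Function.update Y j (δ (Y j))) = 0 := by
    have hswap : Function.update Y j (δ (Y j)) =
        Function.update Y i (δ (Y i)) ∘ Equiv.swap i j := by
      rw [Function.update_comp_equiv, Equiv.symm_swap, Equiv.swap_apply_left, hY,
        Equiv.comp_swap_eq_update, hY, Function.update_eq_self, ← hY, Function.update_eq_self]
    rw [hswap, α.map_swap _ hij, add_neg_cancel]
  have hrest : ∀ l, l ≠ i ∧ l ≠ j → α (Function.update Y l (δ (Y l))) = 0 := fun l hl =>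
    α.map_eq_zero_of_eq _
      (by rw [Function.update_of_ne hl.1.symm, Function.update_of_ne hl.2.symm, hY]) hij
  rw [cochainLie, α.map_eq_zero_of_eq Y hY hij, map_zero, zero_sub, neg_eq_zero,
    Fintype.sum_eq_add i j hij hrest, hpair]

/-- The operator induced by a derivation of `L` on alternating forms. -/
def IsModuleDerivation.altLie {D : Derivation ℝ R R} {δ : L → L} (hδ : IsModuleDerivation D δ)
    {k : ℕ} (α : L [⋀^Fin k]→ₗ[R] R) : L [⋀^Fin k]→ₗ[R] R :=
  { MultilinearMap.mk' (cochainLie D δ α) (hδ.cochainLie_update_add α)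
      (hδ.cochainLie_update_smul α) with
    map_eq_zero_of_eq' := fun _ _ _ hY hij => cochainLie_eq_zero_of_eq D δ α hY hij }

namespace IsVolumeForm

variable {k : ℕ} {α : L [⋀^Fin k]→ₗ[R] R}

/-- The divergence, with respect to the volume form `α`, of a derivation `δ` of `L`: the factor by
which its Lie derivative multiplies `α`. -/
def divergence (hα : IsVolumeForm α) {D : Derivation ℝ R R} {δ : L → L}
    (hδ : IsModuleDerivation D δ) : R :=
  (hα.2 (hδ.altLie α)).choose

variable {D : Derivation ℝ R R} {δ : L → L}

theorem cochainLie_apply (hα : IsVolumeForm α) (hδ : IsModuleDerivation D δ) (u : Fin k → L) :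
    cochainLie D δ α u = hα.divergence hδ * α u :=
  (DFunLike.congr_fun (hα.2 (hδ.altLie α)).choose_spec u).symm

theorem divergence_eq_of_forall (hα : IsVolumeForm α) (hδ : IsModuleDerivation D δ) {g : R}
    (h : ∀ u, cochainLie D δ α u = g * α u) : hα.divergence hδ = g :=
  hα.eq_of_forall_mul_eq fun u => by rw [← hα.cochainLie_apply, h]

/-- The divergence of vector fields with respect to a volume form on the base. -/
def vectorDivergence {s : Derivation ℝ R R [⋀^Fin k]→ₗ[R] R} (hs : IsVolumeForm s) :
    Derivation ℝ R R →+ R :=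
  AddMonoidHom.mk' (fun D => hs.divergence (isModuleDerivation_lie D)) fun D D' =>
    hs.divergence_eq_of_forall _ fun Y => by
      rw [add_mul, ← hs.cochainLie_apply, ← hs.cochainLie_apply]
      simp only [cochainLie, add_lie, AlternatingMap.map_update_add, Finset.sum_add_distrib,
        Derivation.add_apply]
      ring

theorem vectorFieldLie_apply {s : Derivation ℝ R R [⋀^Fin k]→ₗ[R] R} (hs : IsVolumeForm s)
    (D : Derivation ℝ R R) (Y : Fin k → Derivation ℝ R R) :
    vectorFieldLie D s Y = hs.vectorDivergence D * s Y :=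
  hs.cochainLie_apply (isModuleDerivation_lie D) Y

end IsVolumeForm

end Volume

section Determinant

variable {ι : Type*} [DecidableEq ι] {R : Type*} [CommRing R]

theorem derivation_prod {S : Type*} [CommSemiring S] [Algebra S R] (D : Derivation S R R)
    (t : Finset ι) (g : ι → R) :
    D (∏ i ∈ t, g i) = ∑ j ∈ t, D (g j) * ∏ i ∈ t.erase j, g i := by
  induction t using Finset.induction_on with
  | empty => simp
  | insert a t ha ih =>
    have hterm : ∀ j ∈ t, D (g j) * ∏ i ∈ (insert a t).erase j, g i =
        g a * (D (g j) * ∏ i ∈ t.erase j, g i) := fun j hj => by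
      rw [Finset.erase_insert_of_ne (ne_of_mem_of_not_mem hj ha).symm,
        Finset.prod_insert fun h => ha (Finset.mem_of_mem_erase h)]
      ring
    rw [Finset.prod_insert ha, Derivation.leibniz, ih, Finset.sum_insert ha,
      Finset.erase_insert ha, Finset.sum_congr rfl hterm, ← Finset.mul_sum, smul_eq_mul,
      smul_eq_mul]
    ring

variable [Fintype ι]

theorem derivation_det_eq_sum_det_updateCol {S : Type*} [CommSemiring S] [Algebra S R]
    (D : Derivation S R R) (A : Matrix ι ι R) :
    D A.det = ∑ j, (A.updateCol j fun i => D (A i j)).det := by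
  have hprod : ∀ (σ : Equiv.Perm ι) j, ∏ i, A.updateCol j (fun i => D (A i j)) (σ i) i =
      D (A (σ j) j) * ∏ i ∈ Finset.univ.erase j, A (σ i) i := fun σ j => by
    rw [← Finset.mul_prod_erase _ _ (Finset.mem_univ j), Matrix.updateCol_self]
    congr 1
    exact Finset.prod_congr rfl fun i hi => Matrix.updateCol_ne (Finset.ne_of_mem_erase hi)
  simp only [Matrix.det_apply, map_sum, Units.smul_def, map_zsmul, derivation_prod, hprod]
  rw [Finset.sum_comm]
  simp only [Finset.smul_sum]

theorem sum_det_updateCol_eq_sum_det_updateRow (A N : Matrix ι ι R) :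
    ∑ j, (A.updateCol j fun i => N i j).det = ∑ i, (A.updateRow i (N i)).det := by
  have hcol : ∑ j, (A.updateCol j fun i => N i j).det = (A.adjugate * N).trace :=
    Finset.sum_congr rfl fun j _ => by
      rw [← Matrix.cramer_apply, Matrix.cramer_eq_adjugate_mulVec]; rfl
  have hrow : ∑ i, (A.updateRow i (N i)).det = (A.transpose.adjugate * N.transpose).trace :=
    Finset.sum_congr rfl fun i _ => by
      rw [← Matrix.cramer_transpose_apply, Matrix.cramer_eq_adjugate_mulVec]; rfl
  rw [hcol, hrow, ← Matrix.adjugate_transpose, ← Matrix.transpose_mul, Matrix.trace_transpose,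
    Matrix.trace_mul_comm]

end Determinant

section DualVolume

variable {R : Type*} [CommRing R] [Algebra ℝ R]
variable {L : Type*} [AddCommGroup L] [Module R L]

namespace IsDualVolume

variable {n : ℕ} {Ω : L [⋀^Fin n]→ₗ[R] R} {V : Dual R L [⋀^Fin n]→ₗ[R] R}
  {D : Derivation ℝ R R} {δ : L → L} {δ' : Dual R L → Dual R L}

theorem cochainLie_mul_add_mul_cochainLie (hV : IsDualVolume Ω V)
    (hpair : ∀ (θ : Dual R L) u, D (θ u) = δ' θ u + θ (δ u))
    (u : Fin n → L) (θ : Fin n → Dual R L) :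
    cochainLie D δ Ω u * V θ + Ω u * cochainLie D δ' V θ = 0 := by
  have hrow : ∀ i, ((Matrix.of fun i j => θ i (u j)).updateRow i
      ((Matrix.of fun i j => δ' (θ i) (u j)) i)).det =
      Ω u * V (Function.update θ i (δ' (θ i))) := fun i => by
    rw [← hV]
    congr 1
    ext a b
    obtain rfl | hab := eq_or_ne a i <;> simp [*]
  have hcol : ∀ j, ((Matrix.of fun i j => θ i (u j)).updateCol j
      fun i => θ i (δ (u j))).det = Ω (Function.update u j (δ (u j))) * V θ := fun j => by
    rw [← hV]
    congr 1
    ext a b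
    obtain rfl | hab := eq_or_ne b j <;> simp [*]
  have hdet : D (Ω u * V θ) = ∑ i, Ω u * V (Function.update θ i (δ' (θ i))) +
      ∑ j, Ω (Function.update u j (δ (u j))) * V θ := by
    have hsplit : ∀ j, (fun i => D (θ i (u j))) =
        (fun i => δ' (θ i) (u j)) + fun i => θ i (δ (u j)) := fun j => funext fun i => hpair _ _
    have hmixed := sum_det_updateCol_eq_sum_det_updateRow (Matrix.of fun i j => θ i (u j))
      (Matrix.of fun i j => δ' (θ i) (u j))
    rw [← hV, derivation_det_eq_sum_det_updateCol]
    simp only [Matrix.of_apply, hsplit, Matrix.det_updateCol_add, Finset.sum_add_distrib, hcol]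
      at hmixed ⊢
    rw [hmixed]
    exact congrArg (· + _) (Finset.sum_congr rfl fun i _ => hrow i)
  rw [Derivation.leibniz, ← Finset.mul_sum, ← Finset.sum_mul, smul_eq_mul, smul_eq_mul] at hdet
  simp only [cochainLie]
  linear_combination hdet

theorem divergence_eq_neg (hV : IsDualVolume Ω V) (hΩ : IsVolumeForm Ω) (hVol : IsVolumeForm V)
    (hδ : IsModuleDerivation D δ) (hδ' : IsModuleDerivation D δ')
    (hpair : ∀ (θ : Dual R L) u, D (θ u) = δ' θ u + θ (δ u)) :
    hVol.divergence hδ' = -hΩ.divergence hδ :=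
  hΩ.eq_of_forall_mul_eq fun u => hVol.eq_of_forall_mul_eq fun θ => by
    have h := hV.cochainLie_mul_add_mul_cochainLie hpair u θ
    rw [hΩ.cochainLie_apply hδ, hVol.cochainLie_apply hδ'] at h
    linear_combination h

end IsDualVolume

end DualVolume

section Differential

section Alternating

theorem removeNth_succ_cons {α : Type*} {k : ℕ} (i : Fin (k + 1)) (x : α) (Y : Fin (k + 1) → α) :
    i.succ.removeNth (Fin.cons x Y : Fin (k + 2) → α) = Fin.cons x (i.removeNth Y) := by
  funext j
  refine Fin.cases ?_ (fun j => ?_) j <;> simp [Fin.removeNth]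

variable {R : Type*} [CommRing R] {L : Type*} [AddCommGroup L] [Module R L] {k : ℕ}

theorem neg_one_pow_mul_cons_removeNth (α : L [⋀^Fin (k + 1)]→ₗ[R] R) (Z : L)
    (Y : Fin (k + 1) → L) (j : Fin (k + 1)) :
    (-1) ^ (j : ℕ) * α (Fin.cons Z (j.removeNth Y)) = α (Function.update Y j Z) := by
  have h := α.neg_one_pow_smul_map_insertNth j Z (j.removeNth Y)
  rw [Fin.insertNth_removeNth] at h
  change _ = α (Fin.cons Z (j.removeNth Y)) at h
  rcases Nat.even_or_odd (j : ℕ) with hj | hj <;> simp [← h, hj.neg_one_pow]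

theorem insertFirst_swap {φ : (Fin (k + 2) → L) → R}
    (hadd : ∀ X Z, insertFirst (X + Z) φ = insertFirst X φ + insertFirst Z φ)
    (hself : ∀ (X : L) (W : Fin k → L), φ (Fin.cons X (Fin.cons X W)) = 0)
    {γ : L → L [⋀^Fin (k + 1)]→ₗ[R] R} (hγ : ∀ X, insertFirst X φ = ⇑(γ X)) (X Z : L)
    (W : Fin k → L) : γ X (Fin.cons Z W) = -γ Z (Fin.cons X W) := by
  have hγself : ∀ X, γ X (Fin.cons X W) = 0 := fun X => by
    rw [← hself X W, ← congrFun (hγ X)]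
    rfl
  have hγadd : γ (X + Z) = γ X + γ Z := DFunLike.coe_injective <| by
    rw [← hγ, hadd, hγ, hγ]
    rfl
  have hcons : ∀ g : L [⋀^Fin (k + 1)]→ₗ[R] R,
      g (Fin.cons (X + Z) W) = g (Fin.cons X W) + g (Fin.cons Z W) := fun g =>
    g.toMultilinearMap.cons_add W X Z
  have h := hγself (X + Z)
  rw [hγadd, AlternatingMap.add_apply, hcons, hcons, hγself, hγself] at h
  linear_combination h

theorem exists_alternatingMap_eq_of_insertFirst {φ : (Fin (k + 2) → L) → R}
    (hadd : ∀ X Z, insertFirst (X + Z) φ = insertFirst X φ + insertFirst Z φ)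
    (hself : ∀ (X : L) (W : Fin k → L), φ (Fin.cons X (Fin.cons X W)) = 0)
    (halt : ∀ X, ∃ γ : L [⋀^Fin (k + 1)]→ₗ[R] R, insertFirst X φ = ⇑γ) :
    ∃ β : L [⋀^Fin (k + 2)]→ₗ[R] R, φ = ⇑β := by
  choose γ hγ using halt
  have hφ : ∀ Y, φ Y = γ (Y 0) (Fin.tail Y) := fun Y => by
    rw [← congrFun (hγ _), insertFirst, Fin.cons_self_tail]
  have hswap := insertFirst_swap hadd hself hγ
  have hsmul : ∀ (f : R) X, γ (f • X) = f • γ X := fun f X => AlternatingMap.ext fun Y => by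
    rw [← Fin.cons_self_tail Y, hswap, AlternatingMap.smul_apply, hswap X, smul_neg]
    exact congrArg Neg.neg ((γ (Y 0)).toMultilinearMap.cons_smul (Fin.tail Y) f X)
  have hmem : ∀ {X} Y j, Y j = X → γ X Y = 0 := fun {X} Y j h => by
    rw [← Function.update_eq_self j Y, ← neg_one_pow_mul_cons_removeNth, h,
      ← congrFun (hγ X), insertFirst, hself, mul_zero]
  let g : L →ₗ[R] MultilinearMap R (fun _ : Fin (k + 1) => L) R :=
    { toFun := fun X => (γ X).toMultilinearMap
      map_add' := fun X Z => MultilinearMap.ext fun Y => by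
        have h := congrFun (hadd X Z) Y
        rw [hγ, hγ, hγ] at h
        exact h
      map_smul' := fun f X => by rw [hsmul]; rfl }
  have hzero : ∀ (Y : Fin (k + 2) → L) i j, Y i = Y j → i ≠ j → γ (Y 0) (Fin.tail Y) = 0 := by
    intro Y i j hY hij
    rcases Fin.eq_zero_or_eq_succ i with rfl | ⟨i, rfl⟩
    · rcases Fin.eq_zero_or_eq_succ j with rfl | ⟨j, rfl⟩
      · exact absurd rfl hij
      · exact hmem (Fin.tail Y) j hY.symm
    · rcases Fin.eq_zero_or_eq_succ j with rfl | ⟨j, rfl⟩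
      · exact hmem (Fin.tail Y) i hY
      · exact (γ (Y 0)).map_eq_zero_of_eq _ hY fun h => hij (congrArg Fin.succ h)
  let G : MultilinearMap R (fun _ : Fin (k + 2) => L) R := LinearMap.uncurryLeft g
  exact ⟨{ G with map_eq_zero_of_eq' := hzero }, funext hφ⟩

end Alternating

variable {R : Type*} [CommRing R] [Algebra ℝ R]
variable {L : Type*} [AddCommGroup L] [Module R L]

namespace LieAlgebroid

variable (𝒜 : LieAlgebroid R L) {k : ℕ}

theorem bracket_swap (X Y : L) : 𝒜.bracket Y X = -𝒜.bracket X Y := by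
  have h := 𝒜.bracket_self (X + Y)
  simp only [map_add, AddMonoidHom.add_apply, 𝒜.bracket_self, zero_add, add_zero] at h
  exact eq_neg_of_add_eq_zero_left h

theorem isModuleDerivation_bracket (X : L) :
    IsModuleDerivation (𝒜.anchor X) (𝒜.bracket X) where
  add := map_add _
  smul := 𝒜.leibniz X

theorem d_add (α β : (Fin k → L) → R) : 𝒜.d (α + β) = 𝒜.d α + 𝒜.d β := by
  cases k with
  | zero => ext X; simp [d]
  | succ k =>
    ext X
    simp only [d, Pi.add_apply, map_add, mul_add, Finset.sum_add_distrib]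
    ring

theorem d_zero : 𝒜.d (0 : (Fin k → L) → R) = 0 :=
  left_eq_add.1 (by rw [← 𝒜.d_add (0 : (Fin k → L) → R) 0, add_zero])

theorem lieForm_add_left (X Z : L) (α : L [⋀^Fin k]→ₗ[R] R) :
    𝒜.lieForm (X + Z) α = 𝒜.lieForm X α + 𝒜.lieForm Z α := by
  ext Y
  simp only [lieForm, cochainLie, map_add, AddMonoidHom.add_apply, Pi.add_apply,
    AlternatingMap.map_update_add, Finset.sum_add_distrib, Derivation.add_apply]
  ring

theorem lieForm_cons_self (α : L [⋀^Fin (k + 1)]→ₗ[R] R) (X : L) (Y : Fin k → L) :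
    𝒜.lieForm X α (Fin.cons X Y) = 𝒜.lieForm X (insertFirst X α) Y := by
  simp only [lieForm, cochainLie, insertFirst]
  rw [Fin.sum_univ_succ]
  simp only [Fin.cons_zero, 𝒜.bracket_self, Fin.cons_succ, Fin.cons_update]
  rw [α.map_coord_zero (0 : Fin (k + 1)) (Function.update_self _ _ _), zero_add]

theorem d_apply (α : L [⋀^Fin k]→ₗ[R] R) (Y : Fin (k + 1) → L) :
    𝒜.d α Y = ∑ j : Fin (k + 1), (-1) ^ (j : ℕ) * (𝒜.anchor (Y j) (α (j.removeNth Y)) +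
      ∑ i : Fin k with i.castSucc < j,
        α (Function.update (j.removeNth Y) i (𝒜.bracket (Y i.castSucc) (Y j)))) := by
  cases k with
  | zero => simp [d, Subsingleton.elim _ Fin.elim0]
  | succ k =>
    simp only [d, mul_add, Finset.sum_add_distrib, ← neg_one_pow_mul_cons_removeNth,
      Finset.mul_sum, pow_add]
    exact congrArg (_ + ·) (Finset.sum_congr rfl fun j _ => Finset.sum_congr rfl fun i _ => by ring)

theorem insertFirst_d (α : L [⋀^Fin (k + 1)]→ₗ[R] R) (X : L) :
    insertFirst X (𝒜.d α) = 𝒜.lieForm X α - 𝒜.d (insertFirst X α) := by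
  ext Y
  have hbracket : ∀ j : Fin (k + 1), ∑ i : Fin (k + 1) with i.castSucc < j.succ,
      α (Function.update (Fin.cons X (j.removeNth Y)) i
        (𝒜.bracket ((Fin.cons X Y : Fin (k + 2) → L) i.castSucc) (Y j))) =
      α (Fin.cons (𝒜.bracket X (Y j)) (j.removeNth Y)) +
      ∑ i : Fin k with i.castSucc < j, α.curryLeft X
        (Function.update (j.removeNth Y) i (𝒜.bracket (Y i.castSucc) (Y j))) := fun j => by
    simp only [Finset.sum_filter]
    rw [Fin.sum_univ_succ]
    simp only [Fin.castSucc_zero, Fin.succ_pos, if_true, Fin.cons_zero, Fin.update_cons_zero,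
      Fin.castSucc_succ, Fin.succ_lt_succ_iff, Fin.cons_succ, ← Fin.cons_update,
      AlternatingMap.curryLeft_apply_apply]
    rfl
  have hsucc : ∀ j : Fin (k + 1), (-1) ^ ((j.succ : Fin (k + 2)) : ℕ) *
      (𝒜.anchor (Y j) (α (Fin.cons X (j.removeNth Y))) +
        ∑ i : Fin (k + 1) with i.castSucc < j.succ,
          α (Function.update (Fin.cons X (j.removeNth Y)) i
            (𝒜.bracket ((Fin.cons X Y : Fin (k + 2) → L) i.castSucc) (Y j)))) =
      -α (Function.update Y j (𝒜.bracket X (Y j))) -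
      (-1) ^ (j : ℕ) * (𝒜.anchor (Y j) (α.curryLeft X (j.removeNth Y)) +
        ∑ i : Fin k with i.castSucc < j, α.curryLeft X
          (Function.update (j.removeNth Y) i (𝒜.bracket (Y i.castSucc) (Y j)))) := fun j => by
    rw [hbracket, ← neg_one_pow_mul_cons_removeNth, Fin.val_succ, pow_succ]
    change _ = _ - _ * (𝒜.anchor (Y j) (α (Fin.cons X (j.removeNth Y))) + _)
    ring
  change 𝒜.d α (Fin.cons X Y) = cochainLie _ _ α Y - 𝒜.d (α.curryLeft X) Y
  rw [d_apply, d_apply, Fin.sum_univ_succ]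
  simp only [removeNth_succ_cons, Fin.cons_succ, hsucc, cochainLie, Finset.sum_sub_distrib,
    Finset.sum_neg_distrib]
  simp [sub_eq_add_neg, add_assoc]

theorem d_cons_cons_self (α : L [⋀^Fin (k + 1)]→ₗ[R] R) (X : L) (W : Fin k → L) :
    𝒜.d α (Fin.cons X (Fin.cons X W)) = 0 := by
  have h := congrFun (𝒜.insertFirst_d α X) (Fin.cons X W)
  rw [Pi.sub_apply, lieForm_cons_self] at h
  refine h.trans (sub_eq_zero.2 ?_)
  cases k with
  | zero => simp [lieForm, cochainLie, d, Subsingleton.elim W Fin.elim0]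
  | succ k =>
    have hcartan := congrFun (𝒜.insertFirst_d (α.curryLeft X) X) W
    have hzero : insertFirst X (α.curryLeft X) = (0 : (Fin k → L) → R) :=
      funext fun U => DFunLike.congr_fun (α.curryLeft_same X) U
    rw [hzero, d_zero, sub_zero] at hcartan
    exact hcartan.symm

theorem exists_alternatingMap_eq_d (α : L [⋀^Fin k]→ₗ[R] R) :
    ∃ β : L [⋀^Fin (k + 1)]→ₗ[R] R, 𝒜.d α = ⇑β := by
  induction k with
  | zero => exact ⟨AlternatingMap.ofSubsingleton R L R (0 : Fin 1) (𝒜.dFun (α Fin.elim0)), rfl⟩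
  | succ k ih =>
    refine exists_alternatingMap_eq_of_insertFirst (fun X Z => ?_) (𝒜.d_cons_cons_self α)
      fun X => ?_
    · have hinsert : insertFirst (X + Z) α = insertFirst X α + insertFirst Z α :=
        funext fun Y => α.toMultilinearMap.cons_add Y X Z
      rw [insertFirst_d, insertFirst_d, insertFirst_d, hinsert, d_add, lieForm_add_left]
      abel
    · obtain ⟨β, hβ⟩ := ih (α.curryLeft X)
      refine ⟨(𝒜.isModuleDerivation_bracket X).altLie α - β, ?_⟩
      rw [insertFirst_d]
      exact congrArg (_ - ·) hβ

theorem d_insertFirst_eq_lieForm [Subsingleton (L [⋀^Fin (k + 2)]→ₗ[R] R)]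
    (α : L [⋀^Fin (k + 1)]→ₗ[R] R) (X : L) : 𝒜.d (insertFirst X α) = 𝒜.lieForm X α := by
  obtain ⟨β, hβ⟩ := 𝒜.exists_alternatingMap_eq_d α
  have h := 𝒜.insertFirst_d α X
  rw [hβ, Subsingleton.elim β 0] at h
  exact (sub_eq_zero.1 h.symm).symm

end LieAlgebroid

end Differential

section LocalFrames

section ModuleFrames

variable {R L : Type*} [CommRing R] [AddCommGroup L] [Module R L] {n k : ℕ}
  {χ : R} {σ : Fin n → L} {θ : Fin n → Dual R L}

theorem pow_mul_eq_linearCombination (α : L [⋀^Fin k]→ₗ[R] R)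
    (h : ∀ u, χ • u = ∑ i, θ i u • σ i) (u : Fin k → L) :
    χ ^ k * α u = α.compLinearMap (Fintype.linearCombination R σ) fun j i => θ i (u j) := by
  have hsmul := α.map_smul_univ (fun _ => χ) u
  rw [Finset.prod_const, Finset.card_univ, Fintype.card_fin, smul_eq_mul] at hsmul
  simp only [← hsmul, AlternatingMap.compLinearMap_apply, Fintype.linearCombination_apply, h]

theorem pow_mul_eq_det_mul (α : L [⋀^Fin n]→ₗ[R] R) (h : ∀ u, χ • u = ∑ i, θ i u • σ i)
    (u : Fin n → L) : χ ^ n * α u = (Matrix.of fun i j => θ i (u j)).det * α σ := by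
  have hdet := DFunLike.congr_fun
    ((α.compLinearMap (Fintype.linearCombination R σ)).eq_smul_basis_det (Pi.basisFun R (Fin n)))
    fun j i => θ i (u j)
  simp only [AlternatingMap.smul_apply, AlternatingMap.compLinearMap_apply, Pi.basisFun_apply,
    Fintype.linearCombination_apply_single, one_smul, Pi.basisFun_det_apply, smul_eq_mul] at hdet
  rw [pow_mul_eq_linearCombination α h, AlternatingMap.compLinearMap_apply, hdet,
    ← Matrix.det_transpose, mul_comm]
  rfl

theorem pow_mul_eq_zero (β : L [⋀^Fin (n + 1)]→ₗ[R] R) (h : ∀ u, χ • u = ∑ i, θ i u • σ i)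
    (u : Fin (n + 1) → L) : χ ^ (n + 1) * β u = 0 := by
  have hzero : β.compLinearMap (Fintype.linearCombination R σ) = 0 :=
    Basis.ext_alternating (Pi.basisFun R (Fin n)) fun v hv =>
      absurd (Fintype.card_le_of_injective v hv) (by simp)
  rw [pow_mul_eq_linearCombination β h, hzero, AlternatingMap.zero_apply]

end ModuleFrames

variable {m : ℕ} {M : Type*} [TopologicalSpace M] [ChartedSpace (EuclideanSpace ℝ (Fin m)) M]
  {𝕜 : Type*} [RCLike 𝕜]

instance : IsReduced (SmoothFun m M 𝕜) :=
  ⟨fun f ⟨n, hf⟩ => ContMDiffMap.ext fun x => eq_zero_of_pow_eq_zero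
    (n := n) (by simpa using DFunLike.congr_fun hf x)⟩

theorem SmoothFun.apply_eq_zero_of_pow_mul_eq_zero {χ f : SmoothFun m M 𝕜} {x : M} (hχ : χ x = 1)
    {k : ℕ} (h : χ ^ k * f = 0) : f x = 0 := by
  have h := DFunLike.congr_fun h x
  rwa [ContMDiffMap.coe_mul, Pi.mul_apply, ContMDiffMap.coe_pow, Pi.pow_apply, hχ, one_pow,
    one_mul] at h

theorem SmoothFun.exists_eq_mul {ι : Type*} {a b : ι → SmoothFun m M 𝕜}
    (h : ∀ i j, a i * b j = a j * b i) (hb : ∀ x, ∃ i, b i x ≠ 0) :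
    ∃ g : SmoothFun m M 𝕜, ∀ i, a i = g * b i := by
  choose i hi using hb
  have hcross : ∀ x j l, a j x * b l x = a l x * b j x := fun x j l =>
    DFunLike.congr_fun (h j l) x
  refine ⟨⟨fun x => a (i x) x / b (i x) x, fun x => ?_⟩, fun j => ?_⟩
  · have hinv : ContMDiffAt (𝓡 m) 𝓘(ℝ, 𝕜) ∞ (fun y => (b (i x) y)⁻¹) x :=
      (contDiffAt_inv ℝ (hi x)).contMDiffAt.comp x (b (i x)).contMDiff.contMDiffAt
    refine ((a (i x)).contMDiff.contMDiffAt.mul hinv).congr_of_eventuallyEq ?_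
    filter_upwards [(b (i x)).contMDiff.continuous.continuousAt.eventually_ne (hi x)] with y hy
    change a (i y) y / b (i y) y = a (i x) y * (b (i x) y)⁻¹
    rw [← div_eq_mul_inv, div_eq_div_iff (hi y) hy]
    exact hcross y _ _
  · ext x
    change a j x = a (i x) x / b (i x) x * b j x
    rw [div_mul_eq_mul_div, ← hcross, mul_div_cancel_right₀ _ (hi x)]

variable (m M 𝕜) in
/-- The module `L` over the smooth functions has local frames of `n` elements: it is, locally, the
module of sections of a bundle of rank `n`.  The frame `σ` and the dual frame `θ` are multiplied by
cut-off functions so as to be global objects. -/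
def HasLocalFrames (L : Type*) [AddCommGroup L] [Module (SmoothFun m M 𝕜) L] (n : ℕ) : Prop :=
  ∀ x : M, ∃ (χ : SmoothFun m M 𝕜) (σ : Fin n → L) (θ : Fin n → Dual (SmoothFun m M 𝕜) L),
    χ x = 1 ∧ ∀ u, χ • u = ∑ i, θ i u • σ i

namespace HasLocalFrames

variable {L : Type*} [AddCommGroup L] [Module (SmoothFun m M 𝕜) L] {n : ℕ}

theorem dual (hL : HasLocalFrames m M 𝕜 L n) :
    HasLocalFrames m M 𝕜 (Dual (SmoothFun m M 𝕜) L) n := by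
  intro x
  obtain ⟨χ, σ, θ, hχ, h⟩ := hL x
  refine ⟨χ, θ, fun i => Dual.eval _ _ (σ i), hχ, fun η => ?_⟩
  ext1 u
  rw [LinearMap.smul_apply, ← map_smul, h u]
  simp [mul_comm, LinearMap.sum_apply]

theorem apply_mul_apply_comm (hL : HasLocalFrames m M 𝕜 L n)
    (α β : L [⋀^Fin n]→ₗ[SmoothFun m M 𝕜] SmoothFun m M 𝕜) (u v : Fin n → L) :
    α u * β v = α v * β u := by
  ext x
  obtain ⟨χ, σ, θ, hχ, h⟩ := hL x
  refine sub_eq_zero.1 (SmoothFun.apply_eq_zero_of_pow_mul_eq_zero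
    (f := α u * β v - α v * β u) (k := n + n) hχ ?_)
  have hα := pow_mul_eq_det_mul α h
  have hβ := pow_mul_eq_det_mul β h
  linear_combination (χ ^ n * β v) * hα u - (χ ^ n * β u) * hα v +
    ((Matrix.of fun i j => θ i (u j)).det * α σ) * hβ v -
    ((Matrix.of fun i j => θ i (v j)).det * α σ) * hβ u

theorem subsingleton_alternatingMap (hL : HasLocalFrames m M 𝕜 L n) :
    Subsingleton (L [⋀^Fin (n + 1)]→ₗ[SmoothFun m M 𝕜] SmoothFun m M 𝕜) :=
  subsingleton_of_forall_eq 0 fun β => by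
    ext u x
    obtain ⟨χ, σ, θ, hχ, h⟩ := hL x
    exact SmoothFun.apply_eq_zero_of_pow_mul_eq_zero hχ (pow_mul_eq_zero β h u)

theorem isVolumeForm (hL : HasLocalFrames m M 𝕜 L n)
    {α : L [⋀^Fin n]→ₗ[SmoothFun m M 𝕜] SmoothFun m M 𝕜} (hα : NowhereVanishing α) :
    IsVolumeForm α := by
  refine ⟨fun f g hfg => ContMDiffMap.ext fun x => ?_, fun β => ?_⟩
  · obtain ⟨u, hu⟩ := hα x
    exact mul_right_cancel₀ hu (DFunLike.congr_fun (DFunLike.congr_fun hfg u) x)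
  · obtain ⟨g, hg⟩ := SmoothFun.exists_eq_mul (hL.apply_mul_apply_comm β α) hα
    exact ⟨g, AlternatingMap.ext fun u => (hg u).symm⟩

theorem nowhereVanishing_dual (hL : HasLocalFrames m M 𝕜 L n)
    {Ω : L [⋀^Fin n]→ₗ[SmoothFun m M 𝕜] SmoothFun m M 𝕜} (hΩ : NowhereVanishing Ω)
    {V : Dual (SmoothFun m M 𝕜) L [⋀^Fin n]→ₗ[SmoothFun m M 𝕜] SmoothFun m M 𝕜}
    (hV : IsDualVolume Ω V) : NowhereVanishing V := by
  intro x
  obtain ⟨χ, σ, θ, hχ, h⟩ := hL x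
  obtain ⟨u, hu⟩ := hΩ x
  refine ⟨θ, fun hθ => hu ?_⟩
  have hdet := DFunLike.congr_fun (pow_mul_eq_det_mul Ω h u) x
  rw [hV u θ] at hdet
  simpa [hχ, hθ] using hdet

end HasLocalFrames

theorem hasLocalFrames_smoothSec
    {F : Type*} [NormedAddCommGroup F] [NormedSpace ℝ F] [NormedSpace 𝕜 F] [IsScalarTower ℝ 𝕜 F]
    {A : M → Type*} [TopologicalSpace (TotalSpace F A)] [∀ x, TopologicalSpace (A x)]
    [∀ x, AddCommGroup (A x)] [∀ x, Module ℝ (A x)] [∀ x, Module 𝕜 (A x)]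
    [FiberBundle F A] [VectorBundle ℝ F A] [VectorBundle 𝕜 F A]
    [FiniteDimensional 𝕜 F] [T2Space M] [IsManifold (𝓡 m) ∞ M]
    [ContMDiffVectorBundle ∞ F A (𝓡 m)] :
    HasLocalFrames m M 𝕜 (SmoothSec m F A) (finrank 𝕜 F) := by
  intro x
  obtain ⟨χ, σ, θ, hχ, h, -⟩ := exists_cutoff_frame (m := m) (𝕜 := 𝕜) (F := F) (A := A) x
  exact ⟨χ * χ, σ, θ, by simp [hχ.self_of_nhds], h⟩

end LocalFrames

section HadamardLemma

universe u v

variable {E : Type u} [NormedAddCommGroup E] [NormedSpace ℝ E] [ProperSpace E]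
  {G : Type*} [NormedAddCommGroup G] [NormedSpace ℝ G]

theorem hasFDerivAt_intervalIntegral_of_contDiff {f : E × ℝ → G} (hf : ContDiff ℝ 1 f) (a b : ℝ)
    (x : E) :
    HasFDerivAt (fun x => ∫ t in a..b, f (x, t))
      (∫ t in a..b, (fderiv ℝ f (x, t)).comp (ContinuousLinearMap.inl ℝ E ℝ)) x := by
  have hfderiv : Continuous fun p => (fderiv ℝ f p).comp (ContinuousLinearMap.inl ℝ E ℝ) :=
    (hf.continuous_fderiv one_ne_zero).clm_comp continuous_const
  obtain ⟨C, hC⟩ := ((isCompact_closedBall x 1).prod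
    (isCompact_uIcc (a := a) (b := b))).exists_bound_of_continuousOn hfderiv.continuousOn
  refine intervalIntegral.hasFDerivAt_integral_of_dominated_of_fderiv_le (bound := fun _ => C)
    (F' := fun x t => (fderiv ℝ f (x, t)).comp (ContinuousLinearMap.inl ℝ E ℝ))
    (Metric.closedBall_mem_nhds x one_pos)
    (.of_forall fun y => (hf.continuous.comp (by fun_prop)).aestronglyMeasurable)
    ((hf.continuous.comp (by fun_prop)).intervalIntegrable _ _)
    (hfderiv.comp (by fun_prop : Continuous fun t : ℝ => (x, t))).aestronglyMeasurable
    (.of_forall fun t ht y hy => hC (y, t) ⟨hy, Set.uIoc_subset_uIcc ht⟩)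
    intervalIntegrable_const (.of_forall fun t _ y _ => ?_)
  exact (hf.differentiable one_ne_zero (y, t)).hasFDerivAt.comp y (hasFDerivAt_prodMk_left y t)

theorem contDiff_intervalIntegral_of_contDiff {G : Type max u v} [NormedAddCommGroup G]
    [NormedSpace ℝ G] {f : E × ℝ → G} (hf : ContDiff ℝ ∞ f) (a b : ℝ) :
    ContDiff ℝ ∞ fun x => ∫ t in a..b, f (x, t) := by
  refine contDiff_infty.2 fun n => ?_
  induction n generalizing G with
  | zero =>
    exact contDiff_zero.2 <| continuous_iff_continuousAt.2 fun x =>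
      (hasFDerivAt_intervalIntegral_of_contDiff (hf.of_le (by simp)) a b x).continuousAt
  | succ n ih =>
    have hderiv := hasFDerivAt_intervalIntegral_of_contDiff (hf.of_le (by simp)) a b
    rw [Nat.cast_succ, contDiff_succ_iff_fderiv, funext fun x => (hderiv x).fderiv]
    exact ⟨fun x => (hderiv x).differentiableAt, by simp,
      ih (f := fun p => (fderiv ℝ f p).comp (ContinuousLinearMap.inl ℝ E ℝ))
        ((hf.fderiv_right (by simp)).clm_comp contDiff_const)⟩

theorem exists_hadamard_of_contDiff {G : Type max u v} [NormedAddCommGroup G] [NormedSpace ℝ G]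
    [CompleteSpace G] {f : E → G} (hf : ContDiff ℝ ∞ f) (p : E) :
    ∃ g : E → E →L[ℝ] G, ContDiff ℝ ∞ g ∧ g p = fderiv ℝ f p ∧
      ∀ z, f z = f p + g z (z - p) := by
  have hsmooth : ContDiff ℝ ∞ fun q : E × ℝ => fderiv ℝ f (p + q.2 • (q.1 - p)) :=
    (hf.fderiv_right (m := ∞) (by simp)).comp (by fun_prop)
  refine ⟨fun z => ∫ t in (0 : ℝ)..1, fderiv ℝ f (p + t • (z - p)),
    contDiff_intervalIntegral_of_contDiff hsmooth 0 1, by simp, fun z => ?_⟩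
  have hsegment (t : ℝ) : HasDerivAt (fun t : ℝ => f (p + t • (z - p)))
      (fderiv ℝ f (p + t • (z - p)) (z - p)) t := by
    refine (hf.differentiable (by simp) _).hasFDerivAt.comp_hasDerivAt t ?_
    simpa using ((hasDerivAt_id t).smul_const (z - p)).const_add p
  have hcont : Continuous fun t : ℝ => fderiv ℝ f (p + t • (z - p)) :=
    hsmooth.continuous.comp (by fun_prop : Continuous fun t : ℝ => (z, t))
  have hftc := intervalIntegral.integral_eq_sub_of_hasDerivAt (a := 0) (b := 1)
    (fun t _ => hsegment t) ((hcont.clm_apply continuous_const).intervalIntegrable _ _)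
  rw [ContinuousLinearMap.intervalIntegral_apply (hcont.intervalIntegrable _ _), hftc]
  simp

end HadamardLemma

section Coordinates

variable {m : ℕ} {M : Type*} [TopologicalSpace M] [ChartedSpace (EuclideanSpace ℝ (Fin m)) M]
  {𝕜 : Type*} [RCLike 𝕜]

theorem SmoothFun.sum_apply {ι : Type*} (t : Finset ι) (f : ι → SmoothFun m M 𝕜) (x : M) :
    (∑ i ∈ t, f i) x = ∑ i ∈ t, f i x :=
  map_sum (ContMDiffMap.evalRingHom x : SmoothFun m M 𝕜 →+* 𝕜) f t

theorem derivation_const (D : Derivation ℝ (SmoothFun m M 𝕜) (SmoothFun m M 𝕜)) (c : 𝕜) :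
    D (ContMDiffMap.const c) = 0 := by
  set κ : SmoothFun m M 𝕜 := ContMDiffMap.const c
  by_cases hc : ((RCLike.re c : ℝ) : 𝕜) = c
  · have hκ : κ = algebraMap ℝ _ (RCLike.re c) :=
      ContMDiffMap.ext fun _ => hc.symm
    rw [hκ, D.map_algebraMap]
  · -- a constant is a root of the real polynomial `t ^ 2 - 2 re c t + |c| ^ 2`
    have hquadratic : κ * κ = (2 * RCLike.re c) • κ - algebraMap ℝ _ (‖c‖ ^ 2) := by
      have hval : c * c = (2 * RCLike.re c) • c - ((‖c‖ ^ 2 : ℝ) : 𝕜) := by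
        rw [RCLike.real_smul_eq_coe_mul]
        push_cast
        linear_combination c * RCLike.add_conj c - RCLike.mul_conj c
      exact ContMDiffMap.ext fun _ => hval
    have hD := congrArg D hquadratic
    rw [map_sub, D.map_algebraMap, D.map_smul, D.leibniz, smul_eq_mul, sub_zero] at hD
    ext x
    have hDx : c * D κ x + c * D κ x = (2 * RCLike.re c) • D κ x := DFunLike.congr_fun hD x
    rw [RCLike.real_smul_eq_coe_mul, RCLike.ofReal_mul, RCLike.ofReal_ofNat] at hDx
    have hzero : (((RCLike.re c : ℝ) : 𝕜) - c) * D κ x = 0 := by linear_combination -hDx / 2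
    exact (mul_eq_zero.1 hzero).resolve_left (sub_ne_zero.2 hc)

section Locality

variable [T2Space M] [IsManifold (𝓡 m) ∞ M]

theorem SmoothFun.exists_cutoff (𝕜 : Type*) [RCLike 𝕜] {x : M} {s : Set M} (hs : s ∈ 𝓝 x) :
    ∃ χ : SmoothFun m M 𝕜, χ x = 1 ∧ ∀ y ∉ s, χ y = 0 := by
  obtain ⟨f, hf, -⟩ := (SmoothBumpFunction.nhds_basis_support (I := 𝓡 m) hs).mem_iff.1 hs
  refine ⟨⟨fun y => (f y : 𝕜), (RCLike.ofRealCLM (K := 𝕜)).contDiff.contMDiff.comp f.contMDiff⟩,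
    (congrArg _ f.eq_one).trans RCLike.ofReal_one, fun y hy => ?_⟩
  have hfy : f y = 0 := image_eq_zero_of_notMem_tsupport fun h => hy (hf h)
  exact (congrArg _ hfy).trans RCLike.ofReal_zero

theorem derivation_apply_eq_of_eventuallyEq
    (D : Derivation ℝ (SmoothFun m M 𝕜) (SmoothFun m M 𝕜)) {f g : SmoothFun m M 𝕜} {x : M}
    (h : f =ᶠ[𝓝 x] g) : D f x = D g x := by
  obtain ⟨χ, hχ, hχ₀⟩ := SmoothFun.exists_cutoff (m := m) 𝕜 h
  have hmul : χ * (f - g) = 0 := by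
    ext y
    by_cases hy : f y = g y
    · simp [hy]
    · simp [hχ₀ y hy]
  have hD := congrArg D hmul
  rw [D.leibniz, map_zero, map_sub] at hD
  have hDx : χ x * (D f x - D g x) + (f x - g x) * D χ x = 0 := DFunLike.congr_fun hD x
  rw [hχ, h.self_of_nhds, sub_self, zero_mul, add_zero, one_mul] at hDx
  exact sub_eq_zero.1 hDx

end Locality

/-- The expression of a smooth function in the preferred chart at `x₀`; it is meaningful only on the
target of the chart. -/
def SmoothFun.inChart (x₀ : M) (h : SmoothFun m M 𝕜) : EuclideanSpace ℝ (Fin m) → 𝕜 :=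
  h ∘ (extChartAt (𝓡 m) x₀).symm

theorem SmoothFun.inChart_extChartAt {x₀ y : M} (hy : y ∈ (extChartAt (𝓡 m) x₀).source)
    (h : SmoothFun m M 𝕜) : h.inChart x₀ (extChartAt (𝓡 m) x₀ y) = h y :=
  congrArg h ((extChartAt (𝓡 m) x₀).left_inv hy)

section InChart

variable [IsManifold (𝓡 m) ∞ M]

theorem SmoothFun.contDiffOn_inChart (x₀ : M) (h : SmoothFun m M 𝕜) :
    ContDiffOn ℝ ∞ (h.inChart x₀) (extChartAt (𝓡 m) x₀).target :=
  contMDiffOn_iff_contDiffOn.1 (h.contMDiff.comp_contMDiffOn (contMDiffOn_extChartAt_symm x₀))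

theorem SmoothFun.contDiffAt_inChart {x₀ : M} {z : EuclideanSpace ℝ (Fin m)}
    (hz : z ∈ (extChartAt (𝓡 m) x₀).target) (h : SmoothFun m M 𝕜) :
    ContDiffAt ℝ ∞ (h.inChart x₀) z :=
  (h.contDiffOn_inChart x₀).contDiffAt ((isOpen_extChartAt_target x₀).mem_nhds hz)

theorem SmoothFun.contDiffOn_fderiv_inChart_apply (x₀ : M) (h : SmoothFun m M 𝕜)
    (v : EuclideanSpace ℝ (Fin m)) :
    ContDiffOn ℝ ∞ (fun z => fderiv ℝ (h.inChart x₀) z v) (extChartAt (𝓡 m) x₀).target :=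
  ((h.contDiffOn_inChart x₀).fderiv_of_isOpen (isOpen_extChartAt_target x₀)
    (by simp)).clm_apply contDiffOn_const

end InChart

variable {x₀ : M} (b : SmoothBumpFunction (𝓡 m) x₀)

theorem bump_eq_zero_of_notMem_source {y : M} (hy : y ∉ (extChartAt (𝓡 m) x₀).source) :
    b y = 0 :=
  Function.notMem_support.1 fun h => hy (extChartAt_source (𝓡 m) x₀ ▸ b.support_subset_source h)

variable {b} in
theorem mem_source_of_bump_eventuallyEq_one {y : M} (hb : b =ᶠ[𝓝 y] 1) :
    y ∈ (extChartAt (𝓡 m) x₀).source :=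
  by_contra fun h => one_ne_zero (hb.self_of_nhds.symm.trans (bump_eq_zero_of_notMem_source b h))

variable {b} in
theorem eventually_bump_symm_eq_one {y : M} (hb : b =ᶠ[𝓝 y] 1) :
    ∀ᶠ z in 𝓝 (extChartAt (𝓡 m) x₀ y), z ∈ (extChartAt (𝓡 m) x₀).target ∧
      b ((extChartAt (𝓡 m) x₀).symm z) = 1 := by
  have hy := mem_source_of_bump_eventuallyEq_one hb
  have hsymm := continuousAt_extChartAt_symm' (I := 𝓡 m) hy
  rw [ContinuousAt, (extChartAt (𝓡 m) x₀).left_inv hy] at hsymm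
  exact .and ((isOpen_extChartAt_target x₀).mem_nhds ((extChartAt (𝓡 m) x₀).map_source hy))
    (hsymm.eventually hb)

theorem exists_contDiff_eventuallyEq_inChart [IsManifold (𝓡 m) ∞ M] (h : SmoothFun m M 𝕜) :
    ∃ f : EuclideanSpace ℝ (Fin m) → 𝕜, ContDiff ℝ ∞ f ∧
      ∀ y, b =ᶠ[𝓝 y] 1 → f =ᶠ[𝓝 (extChartAt (𝓡 m) x₀ y)] h.inChart x₀ := by
  refine ⟨fun z => b.toContDiffBump z • h.inChart x₀ z, ?_, fun y hb => ?_⟩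
  · refine contMDiff_iff_contDiff.1 (contMDiff_of_tsupport fun z hz => ?_)
    have hz' : z ∈ (extChartAt (𝓡 m) x₀).target := by
      have hz := tsupport_smul_subset_left _ _ hz
      rw [ContDiffBump.tsupport_eq] at hz
      exact b.closedBall_subset ⟨hz, by simp⟩
    exact (b.toContDiffBump.contDiffAt.smul (h.contDiffAt_inChart hz')).contMDiffAt
  · filter_upwards [eventually_bump_symm_eq_one hb] with z hz
    have hbump := b.eqOn_source
      (extChartAt_source (𝓡 m) x₀ ▸ (extChartAt (𝓡 m) x₀).map_target hz.1)
    rw [hz.2, Function.comp_apply, (extChartAt (𝓡 m) x₀).right_inv hz.1] at hbump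
    rw [← hbump, one_smul]

variable [T2Space M] [IsManifold (𝓡 m) ∞ M]

/-- A smooth function `g` on the target of the chart at `x₀`, transported to the manifold and cut
off by the bump function `b`. -/
def chartPullback {g : EuclideanSpace ℝ (Fin m) → 𝕜}
    (hg : ContDiffOn ℝ ∞ g (extChartAt (𝓡 m) x₀).target) : SmoothFun m M 𝕜 :=
  ⟨fun y => b y • g (extChartAt (𝓡 m) x₀ y), b.contMDiff_smul <|
    hg.contMDiffOn.comp contMDiffOn_extChartAt fun y hy =>
      (extChartAt (𝓡 m) x₀).map_source (by rwa [extChartAt_source])⟩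

theorem chartPullback_apply {g : EuclideanSpace ℝ (Fin m) → 𝕜}
    (hg : ContDiffOn ℝ ∞ g (extChartAt (𝓡 m) x₀).target) {y : M} (hy : b y = 1) :
    chartPullback b hg y = g (extChartAt (𝓡 m) x₀ y) :=
  (congrArg (· • g (extChartAt (𝓡 m) x₀ y)) hy).trans (one_smul _ _)

theorem inChart_chartPullback {g : EuclideanSpace ℝ (Fin m) → 𝕜}
    (hg : ContDiffOn ℝ ∞ g (extChartAt (𝓡 m) x₀).target) {y : M} (hb : b =ᶠ[𝓝 y] 1) :
    (chartPullback b hg).inChart x₀ =ᶠ[𝓝 (extChartAt (𝓡 m) x₀ y)] g := by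
  filter_upwards [eventually_bump_symm_eq_one hb] with z hz
  rw [SmoothFun.inChart, Function.comp_apply, chartPullback_apply b hg hz.2,
    (extChartAt (𝓡 m) x₀).right_inv hz.1]

/-- The `i`-th coordinate vector field of the chart at `x₀`, cut off by the bump function `b`. -/
def coordField (𝕜 : Type*) [RCLike 𝕜] (i : Fin m) :
    Derivation ℝ (SmoothFun m M 𝕜) (SmoothFun m M 𝕜) :=
  have hdiff (h : SmoothFun m M 𝕜) {y : M} (hy : y ∈ (extChartAt (𝓡 m) x₀).source) :
      DifferentiableAt ℝ (h.inChart x₀) (extChartAt (𝓡 m) x₀ y) :=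
    (h.contDiffAt_inChart ((extChartAt (𝓡 m) x₀).map_source hy)).differentiableAt (by simp)
  Derivation.mk'
    { toFun := fun h => chartPullback b (h.contDiffOn_fderiv_inChart_apply x₀
        (EuclideanSpace.single i 1))
      map_add' := fun h k => by
        ext y
        change b y • (_ : 𝕜) = b y • (_ : 𝕜) + b y • (_ : 𝕜)
        by_cases hy : y ∈ (extChartAt (𝓡 m) x₀).source
        · rw [← smul_add]
          exact congrArg (b y • · (EuclideanSpace.single i 1))
            (fderiv_add (hdiff h hy) (hdiff k hy))
        · simp [bump_eq_zero_of_notMem_source b hy]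
      map_smul' := fun c h => by
        ext y
        change b y • (_ : 𝕜) = c • (b y • (_ : 𝕜))
        by_cases hy : y ∈ (extChartAt (𝓡 m) x₀).source
        · rw [smul_comm c]
          exact congrArg (b y • · (EuclideanSpace.single i 1)) (fderiv_const_smul (hdiff h hy) c)
        · simp [bump_eq_zero_of_notMem_source b hy] }
    fun h k => by
      ext y
      change b y • (_ : 𝕜) = h y * (b y • (_ : 𝕜)) + k y * (b y • (_ : 𝕜))
      by_cases hy : y ∈ (extChartAt (𝓡 m) x₀).source
      · have hmul := fderiv_mul (hdiff h hy) (hdiff k hy)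
        rw [h.inChart_extChartAt hy, k.inChart_extChartAt hy] at hmul
        rw [mul_smul_comm, mul_smul_comm, ← smul_add]
        exact congrArg (b y • · (EuclideanSpace.single i 1)) hmul
      · simp [bump_eq_zero_of_notMem_source b hy]

variable {b}

theorem coordField_apply {y : M} (hy : b y = 1) (i : Fin m) (h : SmoothFun m M 𝕜) :
    coordField b 𝕜 i h y = fderiv ℝ (h.inChart x₀) (extChartAt (𝓡 m) x₀ y)
      (EuclideanSpace.single i 1) :=
  chartPullback_apply b (h.contDiffOn_fderiv_inChart_apply x₀ _) hy

theorem contDiff_ofReal_coord (i : Fin m) :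
    ContDiff ℝ ∞ fun z : EuclideanSpace ℝ (Fin m) => ((z i : ℝ) : 𝕜) :=
  (RCLike.ofRealCLM (K := 𝕜)).contDiff.comp (by fun_prop)

variable (b) in
/-- The `i`-th coordinate function of the chart at `x₀`, cut off by the bump function `b`. -/
def coordFun (𝕜 : Type*) [RCLike 𝕜] (i : Fin m) : SmoothFun m M 𝕜 :=
  chartPullback b (contDiff_ofReal_coord (𝕜 := 𝕜) i).contDiffOn

theorem coordFun_apply {y : M} (hy : b y = 1) (i : Fin m) :
    coordFun b 𝕜 i y = ((extChartAt (𝓡 m) x₀ y i : ℝ) : 𝕜) :=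
  chartPullback_apply b _ hy

theorem coordField_coordFun (i j : Fin m) {y : M} (hb : b =ᶠ[𝓝 y] 1) :
    coordField b 𝕜 i (coordFun b 𝕜 j) y = if i = j then 1 else 0 := by
  have hcoord : HasFDerivAt (fun z : EuclideanSpace ℝ (Fin m) => ((z j : ℝ) : 𝕜))
      ((RCLike.ofRealCLM (K := 𝕜)).comp (EuclideanSpace.proj j)) (extChartAt (𝓡 m) x₀ y) :=
    ((RCLike.ofRealCLM (K := 𝕜)).comp (EuclideanSpace.proj j)).hasFDerivAt
  rw [coordField_apply hb.self_of_nhds, coordFun, (inChart_chartPullback b _ hb).fderiv_eq,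
    hcoord.fderiv]
  simp [eq_comm, apply_ite]

theorem coordField_comm (i j : Fin m) (h : SmoothFun m M 𝕜) {y : M} (hb : b =ᶠ[𝓝 y] 1) :
    coordField b 𝕜 i (coordField b 𝕜 j h) y = coordField b 𝕜 j (coordField b 𝕜 i h) y := by
  have hsmooth : ContDiffAt ℝ ∞ (h.inChart x₀) (extChartAt (𝓡 m) x₀ y) :=
    h.contDiffAt_inChart ((extChartAt (𝓡 m) x₀).map_source
      (mem_source_of_bump_eventuallyEq_one hb))
  have hsecond (i j : Fin m) : coordField b 𝕜 i (coordField b 𝕜 j h) y =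
      fderiv ℝ (fderiv ℝ (h.inChart x₀)) (extChartAt (𝓡 m) x₀ y)
        (EuclideanSpace.single i 1) (EuclideanSpace.single j 1) := by
    rw [coordField_apply hb.self_of_nhds]
    refine (DFunLike.congr_fun (inChart_chartPullback b
      (h.contDiffOn_fderiv_inChart_apply x₀ _) hb).fderiv_eq _).trans ?_
    rw [fderiv_clm_apply ((hsmooth.fderiv_right (m := ∞) (by simp)).differentiableAt (by simp))
      (by fun_prop)]
    simp
  rw [hsecond, hsecond]
  exact hsmooth.isSymmSndFDerivAt (by simpa using ENat.LEInfty.out) _ _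

theorem exists_eventuallyEq_const_add_sum_coordFun (h : SmoothFun m M 𝕜) {y : M}
    (hb : b =ᶠ[𝓝 y] 1) :
    ∃ g : Fin m → SmoothFun m M 𝕜, (∀ i, g i y = coordField b 𝕜 i h y) ∧
      h =ᶠ[𝓝 y] (ContMDiffMap.const (h y) + ∑ i,
        (coordFun b 𝕜 i - ContMDiffMap.const (coordFun b 𝕜 i y)) * g i : SmoothFun m M 𝕜) := by
  have hy := mem_source_of_bump_eventuallyEq_one hb
  obtain ⟨f, hf, hfh⟩ := exists_contDiff_eventuallyEq_inChart b h
  obtain ⟨g, hg, hgp, hfg⟩ := exists_hadamard_of_contDiff hf (extChartAt (𝓡 m) x₀ y)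
  have hgi (i : Fin m) : ContDiff ℝ ∞ fun z => g z (EuclideanSpace.single i 1) :=
    hg.clm_apply contDiff_const
  refine ⟨fun i => chartPullback b (hgi i).contDiffOn, fun i => ?_, ?_⟩
  · rw [coordField_apply hb.self_of_nhds, chartPullback_apply b _ hb.self_of_nhds, hgp,
      (hfh y hb).fderiv_eq]
  filter_upwards [(continuousAt_extChartAt' (I := 𝓡 m) hy).eventually (hfh y hb), hb,
    (isOpen_extChartAt_source x₀).mem_nhds hy] with x hx hbx hxs
  have hbasis : extChartAt (𝓡 m) x₀ x - extChartAt (𝓡 m) x₀ y = ∑ i,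
      (extChartAt (𝓡 m) x₀ x i - extChartAt (𝓡 m) x₀ y i) • EuclideanSpace.single i (1 : ℝ) := by
    ext j
    simp [Pi.single_apply]
  rw [← h.inChart_extChartAt hxs, ← hx, hfg, (hfh y hb).self_of_nhds, h.inChart_extChartAt hy,
    hbasis, map_sum, ContMDiffMap.coe_add, Pi.add_apply, SmoothFun.sum_apply]
  refine congrArg _ (Finset.sum_congr rfl fun i _ => ?_)
  rw [map_smul, RCLike.real_smul_eq_coe_mul, RCLike.ofReal_sub, ← coordFun_apply (𝕜 := 𝕜) hbx,
    ← coordFun_apply (𝕜 := 𝕜) hb.self_of_nhds, ← chartPullback_apply b (hgi i).contDiffOn hbx]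
  rfl

theorem derivation_apply_eq_sum_coordField
    (D : Derivation ℝ (SmoothFun m M 𝕜) (SmoothFun m M 𝕜)) (h : SmoothFun m M 𝕜) {y : M}
    (hb : b =ᶠ[𝓝 y] 1) : D h y = ∑ i, D (coordFun b 𝕜 i) y * coordField b 𝕜 i h y := by
  obtain ⟨g, hg, hh⟩ := exists_eventuallyEq_const_add_sum_coordFun h hb
  rw [derivation_apply_eq_of_eventuallyEq D hh, map_add, map_sum, derivation_const, zero_add,
    SmoothFun.sum_apply]
  refine Finset.sum_congr rfl fun i _ => ?_
  rw [D.leibniz, map_sub, derivation_const, sub_zero, ← hg]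
  change (coordFun b 𝕜 i y - coordFun b 𝕜 i y) * D (g i) y + g i y * D (coordFun b 𝕜 i) y = _
  ring

end Coordinates

section CoordinateFrames

/-- Coordinates and the corresponding coordinate vector fields on an open subset of a manifold with
ring of functions `R`; the relations between them hold where the cut-off function is `1`. -/
structure CoordinateFrame (R : Type*) [CommRing R] [Algebra ℝ R] (m : ℕ) where
  cutoff : R
  coord : Fin m → R
  field : Fin m → Derivation ℝ R R
  cutoff_smul (D : Derivation ℝ R R) : cutoff • D = ∑ i, (cutoff * D (coord i)) • field i
  cutoff_mul_field_coord (i j : Fin m) :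
    cutoff * field i (coord j) = cutoff * if i = j then 1 else 0
  cutoff_mul_field_comm (i j : Fin m) (f : R) :
    cutoff * field i (field j f) = cutoff * field j (field i f)

theorem derivation_sum_apply {R ι : Type*} [CommRing R] [Algebra ℝ R] (t : Finset ι)
    (D : ι → Derivation ℝ R R) (f : R) : (∑ i ∈ t, D i) f = ∑ i ∈ t, D i f :=
  (congrFun (map_sum Derivation.coeFnAddMonoidHom D t) f).trans (Finset.sum_apply _ _ _)

theorem exists_coordinateFrame {m : ℕ} {M : Type*} [TopologicalSpace M]
    [ChartedSpace (EuclideanSpace ℝ (Fin m)) M] [T2Space M] [IsManifold (𝓡 m) ∞ M]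
    (𝕜 : Type*) [RCLike 𝕜] (x : M) :
    ∃ c : CoordinateFrame (SmoothFun m M 𝕜) m, c.cutoff x = 1 := by
  let b : SmoothBumpFunction (𝓡 m) x := Classical.arbitrary _
  obtain ⟨χ, hχ, hχ₀⟩ := SmoothFun.exists_cutoff (m := m) 𝕜 b.eventuallyEq_one.eventuallyEq_nhds
  have hcutoff {f g : SmoothFun m M 𝕜} (h : ∀ y, b =ᶠ[𝓝 y] 1 → f y = g y) : χ * f = χ * g := by
    ext y
    change χ y * f y = χ y * g y
    by_cases hy : b =ᶠ[𝓝 y] 1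
    · rw [h y hy]
    · rw [hχ₀ y hy, zero_mul, zero_mul]
  refine ⟨⟨χ, coordFun b 𝕜, coordField b 𝕜, fun D => Derivation.ext fun f => ?_,
    fun i j => hcutoff fun y hb => ?_, fun i j f => hcutoff fun y => coordField_comm i j f⟩, hχ⟩
  · simp only [derivation_sum_apply, Derivation.smul_apply, smul_eq_mul, mul_assoc,
      ← Finset.mul_sum]
    refine hcutoff fun y hb => ?_
    rw [derivation_apply_eq_sum_coordField D f hb, SmoothFun.sum_apply]
    rfl
  · rw [coordField_coordFun i j hb]
    split_ifs <;> rfl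

/-- The one-form `χ dxᵢ`, where `χ` is the cut-off function and `xᵢ` the `i`-th coordinate. -/
def CoordinateFrame.coframe {R : Type*} [CommRing R] [Algebra ℝ R] {m : ℕ}
    (c : CoordinateFrame R m) (i : Fin m) : Dual R (Derivation ℝ R R) where
  toFun D := c.cutoff * D (c.coord i)
  map_add' _ _ := mul_add _ _ _
  map_smul' _ _ := mul_left_comm _ _ _

theorem hasLocalFrames_derivation {m : ℕ} {M : Type*} [TopologicalSpace M]
    [ChartedSpace (EuclideanSpace ℝ (Fin m)) M] [T2Space M] [IsManifold (𝓡 m) ∞ M]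
    {𝕜 : Type*} [RCLike 𝕜] :
    HasLocalFrames m M 𝕜 (Derivation ℝ (SmoothFun m M 𝕜) (SmoothFun m M 𝕜)) m := by
  intro x
  obtain ⟨c, hc⟩ := exists_coordinateFrame (m := m) 𝕜 x
  exact ⟨c.cutoff, c.field, c.coframe, hc, c.cutoff_smul⟩

end CoordinateFrames

section Divergence

variable {R : Type*} [CommRing R] [Algebra ℝ R]

theorem sq_mul_derivation_eq {e a b : R} (h : e * a = e * b) (D : Derivation ℝ R R) :
    e ^ 2 * D a = e ^ 2 * D b := by
  have hD := congrArg D h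
  simp only [D.leibniz, smul_eq_mul] at hD
  linear_combination e * hD - D e * h

theorem sum_sum_eq_zero_of_antisymm {ι : Type*} [Fintype ι] {A : ι → ι → R}
    (hA : ∀ i j, A i j = -A j i) : ∑ i, ∑ j, A i j = 0 := by
  have hneg : ∑ i, ∑ j, A i j = -∑ i, ∑ j, A i j := by
    conv_lhs => rw [Finset.sum_comm]
    simp only [← Finset.sum_neg_distrib, ← hA]
  have htwo : (2 : ℝ) • ∑ i, ∑ j, A i j = 0 := by
    rw [two_smul]
    exact eq_neg_iff_add_eq_zero.1 hneg
  exact (smul_eq_zero.1 htwo).resolve_left two_ne_zero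

namespace CoordinateFrame

variable {m : ℕ} (c : CoordinateFrame R m) {s : Derivation ℝ R R [⋀^Fin m]→ₗ[R] R}

theorem cutoff_mul_apply (D : Derivation ℝ R R) (f : R) :
    c.cutoff * D f = ∑ i, c.cutoff * D (c.coord i) * c.field i f := by
  have h := DFunLike.congr_fun (c.cutoff_smul D) f
  simpa only [derivation_sum_apply, Derivation.smul_apply, smul_eq_mul] using h

theorem cutoff_mul_update (s : Derivation ℝ R R [⋀^Fin m]→ₗ[R] R) (D : Derivation ℝ R R)
    (i : Fin m) :
    c.cutoff * s (Function.update c.field i D) = c.cutoff * (D (c.coord i) * s c.field) := by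
  rw [← smul_eq_mul, ← s.map_update_smul, c.cutoff_smul, s.map_update_sum,
    Finset.sum_eq_single_of_mem i (Finset.mem_univ i)]
  · rw [s.map_update_smul, Function.update_eq_self, smul_eq_mul, mul_assoc]
  · intro j _ hj
    rw [s.map_update_smul, s.map_update_self c.field hj.symm, smul_zero]

theorem sq_cutoff_mul_derivation_field_coord (D : Derivation ℝ R R) (i : Fin m) :
    c.cutoff ^ 2 * D (c.field i (c.coord i)) = 0 := by
  have h := sq_mul_derivation_eq (c.cutoff_mul_field_coord i i) D
  rwa [if_pos rfl, D.map_one_eq_zero, mul_zero] at h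

theorem sq_cutoff_mul_divergence (hs : IsVolumeForm s) (D : Derivation ℝ R R) :
    c.cutoff ^ 2 * (hs.vectorDivergence D * s c.field) =
      c.cutoff ^ 2 * ∑ i, c.field i (s c.field * D (c.coord i)) := by
  have hterm (i : Fin m) :
      c.cutoff * (c.cutoff * D (c.coord i) * c.field i (s c.field)) -
        c.cutoff * (c.cutoff * s (Function.update c.field i ⁅D, c.field i⁆)) =
      c.cutoff ^ 2 * c.field i (s c.field * D (c.coord i)) := by
    rw [cutoff_mul_update, Derivation.commutator_apply, Derivation.leibniz, smul_eq_mul,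
      smul_eq_mul]
    linear_combination -s c.field * c.sq_cutoff_mul_derivation_field_coord D i
  calc c.cutoff ^ 2 * (hs.vectorDivergence D * s c.field)
      = c.cutoff * (c.cutoff * D (s c.field)) -
          c.cutoff * (c.cutoff * ∑ i, s (Function.update c.field i ⁅D, c.field i⁆)) := by
        rw [← hs.vectorFieldLie_apply, vectorFieldLie, cochainLie]
        ring
    _ = c.cutoff ^ 2 * ∑ i, c.field i (s c.field * D (c.coord i)) := by
        rw [cutoff_mul_apply]
        simp only [Finset.mul_sum, ← Finset.sum_sub_distrib, hterm]

theorem pow_cutoff_mul_divergence_eq_zero (hs : IsVolumeForm s) {H : R → Derivation ℝ R R}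
    (hH : ∀ f g, H f g = -H g f) {Z : Derivation ℝ R R}
    (hZ : ∀ f, Z f = hs.vectorDivergence (H f)) :
    c.cutoff ^ 4 * (hs.vectorDivergence Z * s c.field) = 0 := by
  have hfield (i : Fin m) : c.cutoff ^ 4 * c.field i (s c.field * Z (c.coord i)) =
      ∑ j, c.cutoff ^ 4 * c.field i (c.field j (s c.field * H (c.coord i) (c.coord j))) := by
    have h := c.sq_cutoff_mul_divergence hs (H (c.coord i))
    rw [← hZ, mul_comm (Z _)] at h
    simpa only [← pow_mul, map_sum, Finset.mul_sum] using sq_mul_derivation_eq h (c.field i)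
  have hantisymm (i j : Fin m) :
      c.cutoff ^ 4 * c.field i (c.field j (s c.field * H (c.coord i) (c.coord j))) =
        -(c.cutoff ^ 4 * c.field j (c.field i (s c.field * H (c.coord j) (c.coord i)))) := by
    rw [hH (c.coord j), mul_neg, map_neg, map_neg]
    linear_combination c.cutoff ^ 3 *
      c.cutoff_mul_field_comm i j (s c.field * H (c.coord i) (c.coord j))
  calc c.cutoff ^ 4 * (hs.vectorDivergence Z * s c.field)
      = ∑ i, c.cutoff ^ 4 * c.field i (s c.field * Z (c.coord i)) := by
        rw [← Finset.mul_sum]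
        linear_combination c.cutoff ^ 2 * c.sq_cutoff_mul_divergence hs Z
    _ = 0 := by
        simp only [hfield]
        exact sum_sum_eq_zero_of_antisymm hantisymm

end CoordinateFrame

theorem divergence_eq_zero_of_antisymm {m : ℕ} {M : Type*} [TopologicalSpace M]
    [ChartedSpace (EuclideanSpace ℝ (Fin m)) M] [T2Space M] [IsManifold (𝓡 m) ∞ M]
    {𝕜 : Type*} [RCLike 𝕜]
    {s : Derivation ℝ (SmoothFun m M 𝕜) (SmoothFun m M 𝕜) [⋀^Fin m]→ₗ[SmoothFun m M 𝕜]
      SmoothFun m M 𝕜} (hs : IsVolumeForm s)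
    {H : SmoothFun m M 𝕜 → Derivation ℝ (SmoothFun m M 𝕜) (SmoothFun m M 𝕜)}
    (hH : ∀ f g, H f g = -H g f) {Z : Derivation ℝ (SmoothFun m M 𝕜) (SmoothFun m M 𝕜)}
    (hZ : ∀ f, Z f = hs.vectorDivergence (H f)) : hs.vectorDivergence Z = 0 := by
  refine hs.eq_of_forall_mul_eq fun Y => ContMDiffMap.ext fun x => ?_
  obtain ⟨c, hc⟩ := exists_coordinateFrame (m := m) 𝕜 x
  rw [zero_mul]
  refine SmoothFun.apply_eq_zero_of_pow_mul_eq_zero (k := m + 4) hc ?_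
  linear_combination (c.cutoff ^ 4 * hs.vectorDivergence Z) *
      pow_mul_eq_det_mul (θ := c.coframe) s c.cutoff_smul Y +
    (Matrix.of fun i j => c.coframe i (Y j)).det * c.pow_cutoff_mul_divergence_eq_zero hs hH hZ

end Divergence

section Bialgebroid

variable {R : Type*} [CommRing R] [Algebra ℝ R]
variable {L : Type*} [AddCommGroup L] [Module R L]

namespace LieAlgebroid

theorem isModuleDerivation_lieDual (𝒜 : LieAlgebroid R L) (X : L) :
    IsModuleDerivation (𝒜.anchor X) (𝒜.lieDual X) where
  add θ η := by
    ext Y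
    simp only [lieDual, LinearMap.coe_mk, AddHom.coe_mk, LinearMap.add_apply, map_add]
    ring
  smul f θ := by
    ext Y
    simp only [lieDual, LinearMap.coe_mk, AddHom.coe_mk, LinearMap.add_apply,
      LinearMap.smul_apply, smul_eq_mul, Derivation.leibniz]
    ring

theorem isBV_neg_divergence (𝒜 : LieAlgebroid R L) {k : ℕ}
    [Subsingleton (L [⋀^Fin (k + 2)]→ₗ[R] R)] {Ω : L [⋀^Fin (k + 1)]→ₗ[R] R}
    (hΩ : IsVolumeForm Ω) (X : L) :
    𝒜.IsBV Ω X (-hΩ.divergence (𝒜.isModuleDerivation_bracket X)) := by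
  rw [IsBV, 𝒜.d_insertFirst_eq_lieForm]
  ext u
  rw [Pi.neg_apply, lieForm, hΩ.cochainLie_apply (𝒜.isModuleDerivation_bracket X), Pi.smul_apply,
    smul_eq_mul, neg_mul]

end LieAlgebroid

variable [IsReflexive R L] {𝒜 : LieAlgebroid R L} {𝒜' : LieAlgebroid R (Dual R L)}

theorem apply_lieBidual (𝒜' : LieAlgebroid R (Dual R L)) (θ η : Dual R L) (u : L) :
    η (lieBidual 𝒜' θ u) = 𝒜'.anchor θ (η u) - 𝒜'.bracket θ η u :=
  congrArg (· η) ((evalEquiv R L).apply_symm_apply (𝒜'.lieDual θ (Dual.eval R L u)))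

theorem isModuleDerivation_lieBidual (𝒜' : LieAlgebroid R (Dual R L)) (θ : Dual R L) :
    IsModuleDerivation (𝒜'.anchor θ) (lieBidual 𝒜' θ) where
  add X Y := by
    simp only [lieBidual, map_add, (𝒜'.isModuleDerivation_lieDual θ).add]
  smul f X := by
    simp only [lieBidual, map_smul, map_add, (𝒜'.isModuleDerivation_lieDual θ).smul]
    exact congrArg (_ • · + _) ((evalEquiv R L).symm_apply_apply X)

/-- The section `d_* f` of `A`, for the differential `d_*` of a Lie algebroid structure on `A*`. -/
def dStar (𝒜' : LieAlgebroid R (Dual R L)) (f : R) : L :=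
  (evalEquiv R L).symm (𝒜'.dFun f)

theorem apply_dStar (𝒜' : LieAlgebroid R (Dual R L)) (f : R) (θ : Dual R L) :
    θ (dStar 𝒜' f) = 𝒜'.anchor θ f :=
  congrArg (· θ) ((evalEquiv R L).apply_symm_apply (𝒜'.dFun f))

theorem IsLieBialgebroid.lieBidual_dFun (h : IsLieBialgebroid 𝒜 𝒜') (f : R) (X : L) :
    lieBidual 𝒜' (𝒜.dFun f) X = 𝒜.bracket X (dStar 𝒜' f) := by
  refine (bijective_dual_eval R L).1 (LinearMap.ext fun θ => ?_)
  have hcartan : 𝒜'.d (oneVec X) (Fin.cons (𝒜.dFun f) fun _ => θ) =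
      𝒜'.anchor (𝒜.dFun f) (θ X) - 𝒜'.bracket (𝒜.dFun f) θ X - 𝒜'.anchor θ (𝒜.anchor X f) := by
    refine (congrFun (𝒜'.insertFirst_d (AlternatingMap.ofSubsingleton R (Dual R L) R (0 : Fin 1)
      (Dual.eval R L X)) (𝒜.dFun f)) fun _ => θ).trans ?_
    simp [LieAlgebroid.lieForm, LieAlgebroid.d, LieAlgebroid.dFun, cochainLie, insertFirst]
  have hsec : 𝒜'.anchor θ (𝒜.anchor X f) =
      -𝒜'.d (oneVec X) (Fin.cons (𝒜.dFun f) fun _ => θ) +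
        (𝒜.anchor X (𝒜'.anchor θ f) - 𝒜'.anchor (𝒜.lieDual X θ) f) := by
    refine (congrFun (h.sec_fun X f) fun _ => θ).trans ?_
    simp only [LieAlgebroid.schoutenFun, pow_one, neg_smul, one_smul, LieAlgebroid.lieVec,
      Pi.add_apply, Pi.neg_apply, insertFirst, cochainLie, Nat.reduceAdd,
      Finset.univ_unique, Finset.sum_singleton]
    rfl
  have hdStar : 𝒜'.anchor (𝒜.lieDual X θ) f =
      𝒜.anchor X (𝒜'.anchor θ f) - θ (𝒜.bracket X (dStar 𝒜' f)) := by
    rw [← apply_dStar, ← apply_dStar]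
    rfl
  change θ _ = θ _
  rw [apply_lieBidual]
  linear_combination hsec - hcartan - hdStar

section Compatible

variable (h : ∀ f X, lieBidual 𝒜' (𝒜.dFun f) X = 𝒜.bracket X (dStar 𝒜' f))
include h

theorem anchor_dFun_add_anchor_dFun_smul (f g : R) (X : L) :
    (𝒜'.anchor (𝒜.dFun f) g + 𝒜'.anchor (𝒜.dFun g) f) • X = 0 := by
  have hbidual := (isModuleDerivation_lieBidual 𝒜' (𝒜.dFun f)).smul g X
  rw [h, h, 𝒜.bracket_swap, 𝒜.leibniz, 𝒜.bracket_swap X] at hbidual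
  have hanchor : 𝒜.anchor (dStar 𝒜' f) g = 𝒜'.anchor (𝒜.dFun g) f := apply_dStar 𝒜' f (𝒜.dFun g)
  rw [hanchor, neg_add, smul_neg, neg_neg, add_left_inj] at hbidual
  rw [add_smul, ← hbidual, neg_add_cancel]

theorem anchor_dFun_antisymm [IsReduced R] (f g : R) :
    𝒜'.anchor (𝒜.dFun f) g = -𝒜'.anchor (𝒜.dFun g) f := by
  have hmul : ∀ (θ : Dual R L) X,
      (𝒜'.anchor (𝒜.dFun f) g + 𝒜'.anchor (𝒜.dFun g) f) * θ X = 0 := fun θ X => by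
    rw [← smul_eq_mul, ← map_smul, anchor_dFun_add_anchor_dFun_smul h, map_zero]
  have hf := hmul (𝒜.dFun f) (dStar 𝒜' g)
  have hg := hmul (𝒜.dFun g) (dStar 𝒜' f)
  rw [apply_dStar] at hf hg
  refine eq_neg_of_add_eq_zero_left (pow_eq_zero_iff two_ne_zero |>.1 ?_)
  linear_combination hf + hg

theorem anchor_dStar [IsReduced R] (f : R) :
    𝒜.anchor (dStar 𝒜' f) = -𝒜'.anchor (𝒜.dFun f) := by
  ext g
  rw [Derivation.neg_apply, anchor_dFun_antisymm h, neg_neg]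
  exact apply_dStar 𝒜' f (𝒜.dFun g)

theorem IsVolumeForm.divergence_lieBidual_dFun [IsReduced R] {k : ℕ} {Ω : L [⋀^Fin k]→ₗ[R] R}
    (hΩ : IsVolumeForm Ω) (f : R) :
    hΩ.divergence (isModuleDerivation_lieBidual 𝒜' (𝒜.dFun f)) =
      -hΩ.divergence (𝒜.isModuleDerivation_bracket (dStar 𝒜' f)) :=
  hΩ.divergence_eq_of_forall _ fun u => by
    rw [neg_mul, ← hΩ.cochainLie_apply (𝒜.isModuleDerivation_bracket (dStar 𝒜' f))]
    simp only [cochainLie, h, fun X => 𝒜.bracket_swap X (dStar 𝒜' f), anchor_dStar h,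
      AlternatingMap.map_update_neg, Finset.sum_neg_distrib, Derivation.neg_apply]
    ring

end Compatible

end Bialgebroid

section ModularCocycle

variable {R : Type*} [CommRing R] [Algebra ℝ R]
variable {L : Type*} [AddCommGroup L] [Module R L]
variable {𝒜 : LieAlgebroid R L} {𝒜' : LieAlgebroid R (Dual R L)} {m n : ℕ}
  {Ω : L [⋀^Fin n]→ₗ[R] R} {V : Dual R L [⋀^Fin n]→ₗ[R] R}
  {s : Derivation ℝ R R [⋀^Fin m]→ₗ[R] R} {X₀ : L} {ξ₀ : Dual R L}

theorem IsDualVolume.divergence_lieDual (hV : IsDualVolume Ω V) (hΩ : IsVolumeForm Ω)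
    (hVol : IsVolumeForm V) (X : L) : hVol.divergence (𝒜.isModuleDerivation_lieDual X) =
      -hΩ.divergence (𝒜.isModuleDerivation_bracket X) :=
  hV.divergence_eq_neg hΩ hVol _ _ fun _ _ => (sub_add_cancel _ _).symm

theorem IsModularCocycle.apply_eq (hξ₀ : IsModularCocycle 𝒜 s V ξ₀) (hV : IsDualVolume Ω V)
    (hΩ : IsVolumeForm Ω) (hVol : IsVolumeForm V) (hs : IsVolumeForm s) (X : L) :
    ξ₀ X = hs.vectorDivergence (𝒜.anchor X) -
      hΩ.divergence (𝒜.isModuleDerivation_bracket X) := by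
  rw [sub_eq_add_neg, ← hV.divergence_lieDual hΩ hVol]
  refine hs.eq_of_forall_mul_eq fun Y => hVol.eq_of_forall_mul_eq fun θ => ?_
  have h := hξ₀ X Y θ
  rw [LieAlgebroid.lieVec, hVol.cochainLie_apply (𝒜.isModuleDerivation_lieDual X),
    hs.vectorFieldLie_apply] at h
  linear_combination -h

variable [IsReflexive R L]

namespace IsDualVolume

theorem divergence_bracket (hV : IsDualVolume Ω V) (hΩ : IsVolumeForm Ω) (hVol : IsVolumeForm V)
    (θ : Dual R L) : hVol.divergence (𝒜'.isModuleDerivation_bracket θ) =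
      -hΩ.divergence (isModuleDerivation_lieBidual 𝒜' θ) :=
  hV.divergence_eq_neg hΩ hVol _ _ fun η u => by rw [apply_lieBidual, add_sub_cancel]

theorem exists_isBV_isBV (hV : IsDualVolume Ω V) (hΩ : IsVolumeForm Ω) (hVol : IsVolumeForm V)
    [Subsingleton (L [⋀^Fin (n + 1)]→ₗ[R] R)] [Subsingleton (Dual R L [⋀^Fin (n + 1)]→ₗ[R] R)]
    (h : hΩ.divergence (isModuleDerivation_lieBidual 𝒜' ξ₀) =
      -hΩ.divergence (𝒜.isModuleDerivation_bracket X₀)) :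
    ∃ f, 𝒜'.IsBV V ξ₀ f ∧ 𝒜.IsBV Ω X₀ f := by
  cases n with
  | zero => exact ⟨0, zero_smul R _, zero_smul R _⟩
  | succ k =>
    refine ⟨-hΩ.divergence (𝒜.isModuleDerivation_bracket X₀), ?_, 𝒜.isBV_neg_divergence hΩ X₀⟩
    rw [← h, ← neg_neg (hΩ.divergence _), ← hV.divergence_bracket hΩ hVol]
    exact 𝒜'.isBV_neg_divergence hVol ξ₀

end IsDualVolume

theorem IsModularCocycleDual.apply_eq (hX₀ : IsModularCocycleDual 𝒜' Ω s X₀)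
    (hΩ : IsVolumeForm Ω) (hs : IsVolumeForm s) (θ : Dual R L) :
    θ X₀ = hΩ.divergence (isModuleDerivation_lieBidual 𝒜' θ) +
      hs.vectorDivergence (𝒜'.anchor θ) :=
  hΩ.eq_of_forall_mul_eq fun u => hs.eq_of_forall_mul_eq fun Y => by
    have h := hX₀ θ u Y
    rw [lieCovec, hΩ.cochainLie_apply (isModuleDerivation_lieBidual 𝒜' θ),
      hs.vectorFieldLie_apply] at h
    linear_combination -h

theorem anchor_sub_anchor_apply_eq_divergence [IsReduced R]
    (h : ∀ f X, lieBidual 𝒜' (𝒜.dFun f) X = 𝒜.bracket X (dStar 𝒜' f))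
    (hV : IsDualVolume Ω V) (hΩ : IsVolumeForm Ω) (hVol : IsVolumeForm V) (hs : IsVolumeForm s)
    (hX₀ : IsModularCocycleDual 𝒜' Ω s X₀) (hξ₀ : IsModularCocycle 𝒜 s V ξ₀) (f : R) :
    (𝒜.anchor X₀ - 𝒜'.anchor ξ₀) f =
      hs.vectorDivergence (𝒜'.anchor (𝒜.dFun f) + 𝒜'.anchor (𝒜.dFun f)) := by
  have hX : 𝒜.anchor X₀ f = _ := hX₀.apply_eq hΩ hs (𝒜.dFun f)
  have hξ := hξ₀.apply_eq hV hΩ hVol hs (dStar 𝒜' f)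
  have hdStar := congrArg hs.vectorDivergence (anchor_dStar h f)
  rw [map_neg] at hdStar
  rw [apply_dStar, hdStar] at hξ
  rw [hΩ.divergence_lieBidual_dFun h] at hX
  rw [Derivation.sub_apply, hX, hξ, map_add]
  ring

end ModularCocycle

theorem corollary2p5_general
    {𝕜 : Type*} [RCLike 𝕜] {m n : ℕ}
    {M : Type*} [TopologicalSpace M] [ChartedSpace (EuclideanSpace ℝ (Fin m)) M]
    [IsManifold (𝓡 m) ∞ M] [T2Space M]
    {L : Type*} [AddCommGroup L] [Module (SmoothFun m M 𝕜) L] [IsReflexive (SmoothFun m M 𝕜) L]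
    (hL : HasLocalFrames m M 𝕜 L n)
    (𝒜 : LieAlgebroid (SmoothFun m M 𝕜) L) (𝒜' : LieAlgebroid (SmoothFun m M 𝕜) (Dual _ L))
    (hbi : ∀ f X, lieBidual 𝒜' (𝒜.dFun f) X = 𝒜.bracket X (dStar 𝒜' f))
    (s : Derivation ℝ (SmoothFun m M 𝕜) (SmoothFun m M 𝕜) [⋀^Fin m]→ₗ[SmoothFun m M 𝕜]
      SmoothFun m M 𝕜) (hs : NowhereVanishing s)
    (Ω : L [⋀^Fin n]→ₗ[SmoothFun m M 𝕜] SmoothFun m M 𝕜) (hΩ : NowhereVanishing Ω)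
    (V : Dual (SmoothFun m M 𝕜) L [⋀^Fin n]→ₗ[SmoothFun m M 𝕜] SmoothFun m M 𝕜)
    (hV : IsDualVolume Ω V)
    (X₀ : L) (hX₀ : IsModularCocycleDual 𝒜' Ω s X₀)
    (ξ₀ : Dual (SmoothFun m M 𝕜) L) (hξ₀ : IsModularCocycle 𝒜 s V ξ₀) :
    𝒜.lieVec X₀ V = -𝒜'.lieForm ξ₀ V ∧
    𝒜.lieForm X₀ Ω = -lieCovec 𝒜' ξ₀ Ω ∧
    (∃ f : SmoothFun m M 𝕜, 𝒜'.IsBV V ξ₀ f ∧ 𝒜.IsBV Ω X₀ f) ∧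
    vectorFieldLie (𝒜.anchor X₀) s = vectorFieldLie (𝒜'.anchor ξ₀) s := by
  have hΩvol := hL.isVolumeForm hΩ
  have hVvol := hL.dual.isVolumeForm (hL.nowhereVanishing_dual hΩ hV)
  have hsvol := hasLocalFrames_derivation.isVolumeForm hs
  have hdiv : hsvol.vectorDivergence (𝒜.anchor X₀) = hsvol.vectorDivergence (𝒜'.anchor ξ₀) := by
    rw [← sub_eq_zero, ← map_sub]
    refine divergence_eq_zero_of_antisymm hsvol (fun f g => ?_)
      (anchor_sub_anchor_apply_eq_divergence hbi hV hΩvol hVvol hsvol hX₀ hξ₀)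
    rw [Derivation.add_apply, Derivation.add_apply, anchor_dFun_antisymm hbi f g, neg_add]
  have hopp : hΩvol.divergence (isModuleDerivation_lieBidual 𝒜' ξ₀) =
      -hΩvol.divergence (𝒜.isModuleDerivation_bracket X₀) := by
    linear_combination hξ₀.apply_eq hV hΩvol hVvol hsvol X₀ - hX₀.apply_eq hΩvol hsvol ξ₀ + hdiv
  have := hL.subsingleton_alternatingMap
  have := hL.dual.subsingleton_alternatingMap
  refine ⟨funext fun θ => ?_, funext fun u => ?_, hV.exists_isBV_isBV hΩvol hVvol hopp,
    funext fun Y => ?_⟩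
  · rw [Pi.neg_apply, LieAlgebroid.lieVec, LieAlgebroid.lieForm,
      hVvol.cochainLie_apply (𝒜.isModuleDerivation_lieDual X₀),
      hVvol.cochainLie_apply (𝒜'.isModuleDerivation_bracket ξ₀),
      hV.divergence_lieDual hΩvol, hV.divergence_bracket hΩvol, hopp, neg_neg, neg_mul]
  · rw [Pi.neg_apply, LieAlgebroid.lieForm, lieCovec,
      hΩvol.cochainLie_apply (𝒜.isModuleDerivation_bracket X₀),
      hΩvol.cochainLie_apply (isModuleDerivation_lieBidual 𝒜' ξ₀), hopp, neg_mul, neg_neg]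
  · rw [hsvol.vectorFieldLie_apply, hsvol.vectorFieldLie_apply, hdiv]

end

theorem corollary2p5
    {𝕜 : Type*} [RCLike 𝕜] {m n : ℕ}
    {M : Type*} [TopologicalSpace M] [ChartedSpace (EuclideanSpace ℝ (Fin m)) M]
    [IsManifold (𝓡 m) ∞ M] [T2Space M] [SecondCountableTopology M]
    {F : Type*} [NormedAddCommGroup F] [NormedSpace ℝ F] [NormedSpace 𝕜 F] [IsScalarTower ℝ 𝕜 F]
    [FiniteDimensional 𝕜 F] (hn : finrank 𝕜 F = n)
    {A : M → Type*} [TopologicalSpace (TotalSpace F A)] [∀ x, TopologicalSpace (A x)]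
    [∀ x, AddCommGroup (A x)] [∀ x, Module ℝ (A x)] [∀ x, Module 𝕜 (A x)]
    [FiberBundle F A] [VectorBundle ℝ F A] [VectorBundle 𝕜 F A]
    [ContMDiffVectorBundle ∞ F A (𝓡 m)]
    (𝒜 : LieAlgebroid (SmoothFun m M 𝕜) (SmoothSec m F A))
    (𝒜' : LieAlgebroid (SmoothFun m M 𝕜) (Dual (SmoothFun m M 𝕜) (SmoothSec m F A)))
    (hbi : IsLieBialgebroid 𝒜 𝒜')
    (s : Derivation ℝ (SmoothFun m M 𝕜) (SmoothFun m M 𝕜) [⋀^Fin m]→ₗ[SmoothFun m M 𝕜]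
      SmoothFun m M 𝕜) (hs : NowhereVanishing s)
    (Ω : SmoothSec m F A [⋀^Fin n]→ₗ[SmoothFun m M 𝕜] SmoothFun m M 𝕜) (hΩ : NowhereVanishing Ω)
    (V : Dual (SmoothFun m M 𝕜) (SmoothSec m F A) [⋀^Fin n]→ₗ[SmoothFun m M 𝕜] SmoothFun m M 𝕜)
    (hV : IsDualVolume Ω V)
    (X₀ : SmoothSec m F A) (hX₀ : IsModularCocycleDual 𝒜' Ω s X₀)
    (ξ₀ : Dual (SmoothFun m M 𝕜) (SmoothSec m F A)) (hξ₀ : IsModularCocycle 𝒜 s V ξ₀) :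
    𝒜.lieVec X₀ V = -𝒜'.lieForm ξ₀ V ∧
    𝒜.lieForm X₀ Ω = -lieCovec 𝒜' ξ₀ Ω ∧
    (∃ f : SmoothFun m M 𝕜, 𝒜'.IsBV V ξ₀ f ∧ 𝒜.IsBV Ω X₀ f) ∧
    vectorFieldLie (𝒜.anchor X₀) s = vectorFieldLie (𝒜'.anchor ξ₀) s :=
  corollary2p5_general (hn ▸ hasLocalFrames_smoothSec) 𝒜 𝒜' hbi.lieBidual_dFun s hs Ω hΩ V hV
    X₀ hX₀ ξ₀ hξ₀
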